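/- Fix $d$. For a finite nonempty set $E\subset\mathbb{Z}^d$ let $\chi_E=\frac1{|E|}1_E$ and, for $f:\mathbb{Z}^d\to\mathbb{C}$, let $\chi_E*f(n)=\frac1{|E|}\sum_{m\in E}f(n-m)$. For $g:\mathbb{Z}^d\to[0,\infty]$ let $\|g\|_{L^{1,\infty}(\mathbb{Z}^d)}=\sup_{t\ge0}t\,|\{n: g(n)>t\}|$. (1) There is a constant $C$ (depending only on $d$) such that for every nested sequence $H_0\subseteq H_1\subseteq\cdots$ of symmetric dyadic rectangles $H_k=\prod_{j=1}^d[-2^{a_j(k)},2^{a_j(k)})\subset\mathbb{Z}^d$, where each $k\mapsto a_j(k)\in\{0,1,2,\dots\}$ is non-decreasing, and every $f\in L^1(\mathbb{Z}^d)$, $$\Big\|\Big(\sum_k|\chi_{H_k}*f-\chi_{H_{k+1}}*f|^2\Big)^{1/2}\Big\|_{L^{1,\infty}(\mathbb{Z}^d)}\le C\|f\|_{L^1(\mathbb{Z}^d)}.$$ (2) There is a constant $C$ (depending only on $d$) such that for every nested sequence $E_0\subseteq E_1\subseteq\cdots$ of axis-parallel rectangles in $\mathbb{Z}^d$ (in arbitrary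 position) with dyadic side lengths, i.e. $E_i=\prod_{j=1}^d[l_j(i),l_j(i)+2^{a_j(i)})$ with $l_j(i)\in\mathbb{Z}$, $a_j(i)\in\{0,1,2,\dots\}$, and every $f\in L^1(\mathbb{Z}^d)$, with $A_if=\chi_{E_i}*f$, $$\Big\|\Big(\sum_i|(A_i-A_{i+1})f|^2\Big)^{1/2}\Big\|_{L^{1,\infty}(\mathbb{Z}^d)}\le C\|f\|_{L^1(\mathbb{Z}^d)}.$$ (3) Consequently, for every such sequence $(E_i)$ as in (2), every probability space $(X,\Sigma,\mu)$ with a measure-preserving $\mathbb{Z}^d$-action $T$, and every $\phi\in L^1(X,\Sigma,\mu)$, with $M_i\phi(x)=\frac1{|E_i|}\sum_{y\in E_i}\phi(T_{-y}x)$, $$\Big(\sum_i|(M_i-M_{i+1})\phi|^2\Big)^{1/2}<\infty\quad\mu\text{-almost everywhere.}$$ -/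

import Mathlib

open MeasureTheory
open scoped ENNReal NNReal

noncomputable section

/-- The axis-parallel rectangle `∏ j, [l j, u j)` in the lattice `ℤ^d`. -/
def latticeBox {d : ℕ} (l u : Fin d → ℤ) : Finset (Fin d → ℤ) :=
  Fintype.piFinset fun j => Finset.Ico (l j) (u j)

/-- The symmetric dyadic rectangle `∏ j, [-2 ^ a j, 2 ^ a j)` in `ℤ^d`. -/
def symmetricDyadicBox {d : ℕ} (a : Fin d → ℕ) : Finset (Fin d → ℤ) :=
  latticeBox (fun j => -2 ^ a j) (fun j => 2 ^ a j)

/-- `E` is an axis-parallel rectangle in `ℤ^d`, in any position, all of whose side lengths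
(numbers of lattice points along a side) are powers of two. -/
def HasDyadicSides {d : ℕ} (E : Finset (Fin d → ℤ)) : Prop :=
  ∃ (l : Fin d → ℤ) (a : Fin d → ℕ), E = latticeBox l (fun j => l j + 2 ^ a j)

/-- The average `(χ_E * f) n = |E|⁻¹ ∑_{m ∈ E} f (n - m)`, that is, the convolution of `f` with the
normalized indicator function `χ_E = |E|⁻¹ 1_E`. -/
def latticeAverage {d : ℕ} (E : Finset (Fin d → ℤ)) (f : (Fin d → ℤ) → ℂ) (n : Fin d → ℤ) : ℂ :=
  (E.card : ℂ)⁻¹ * ∑ m ∈ E, f (n - m)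

/-- The ergodic average `|E|⁻¹ ∑_{y ∈ E} φ (T_{-y} x)` along an action `T` of `ℤ^d` on `X`. -/
def ergodicAverage {d : ℕ} {X : Type*} [AddAction (Fin d → ℤ) X]
    (E : Finset (Fin d → ℤ)) (φ : X → ℂ) (x : X) : ℂ :=
  (E.card : ℂ)⁻¹ * ∑ y ∈ E, φ ((-y) +ᵥ x)

/-- `(∑_i |u i - u (i + 1)|²)^{1/2}`, with values in `[0, ∞]`. -/
def squareVariation (u : ℕ → ℂ) : ℝ≥0∞ :=
  (∑' i, ‖u i - u (i + 1)‖ₑ ^ 2) ^ (1 / 2 : ℝ)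

/-- The square function `(∑_i |χ_{E i} * f - χ_{E (i + 1)} * f|²)^{1/2}` on `ℤ^d`. -/
def squareFunction {d : ℕ} (E : ℕ → Finset (Fin d → ℤ)) (f : (Fin d → ℤ) → ℂ)
    (n : Fin d → ℤ) : ℝ≥0∞ :=
  squareVariation fun i => latticeAverage (E i) f n

/-- The weak `L¹` quasi-norm `‖g‖_{1,∞} = sup_{t ≥ 0} t |{n : g n > t}|` on `ℤ^d`. -/
def weakL1Norm {d : ℕ} (g : (Fin d → ℤ) → ℝ≥0∞) : ℝ≥0∞ :=
  ⨆ t : ℝ≥0, (t : ℝ≥0∞) * Measure.count {n | (t : ℝ≥0∞) < g n}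

end

/-! The averages are Fourier multipliers, and their differences are dominated by the drops of a
decreasing family of positive operators. In one coordinate, with `M = 2 ^ a` and `|u| = 1`, compare
the symbol of an interval of length `M` with `r(u) = |(1 - ρ) / (1 - ρ u)|² = 1 / (1 + c |1 - u|²)`,
`c ≈ M²`, a resolvent of the discrete Laplacian. If two intervals contain the origin and the length
at least doubles, then `|m - m'|² ≤ 146 (r - r')` (`sq_norm_intervalSymbol_sub_le`); this passes to
products over coordinates (`sq_norm_prod_sub_prod_le`). By Parseval, `‖(A_i - A_{i+1}) F‖₂²` is at
most a constant times `⟨R_i F, F⟩ - ⟨R_{i+1} F, F⟩` (`sum_sq_norm_latticeAverage_sub_le`), which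
telescopes for a fixed `F`.

For the weak type bound no cancellation is needed, only a stopping procedure. The grids of boxes
with sides `2 ^ a i j` are nested. Given a height `t`, let `F_i` be `f` restricted to the points
where the grid means of `|f|` at the levels `i, …, N` are at most `t`. Off a set of at most `3 ^ d
‖f‖₁ / t` points, `A_i f = A_i F_i` for all `i ≤ N` (`mul_card_exceptional_le`). On the rest, sum
the energy drops of the varying `F_i` by parts: what remains is the initial energy and the changes
`⟨R_{i+1} F_{i+1}, F_{i+1}⟩ - ⟨R_{i+1} F_i, F_i⟩`. The kernel of `R_i` decays geometrically at scale
`2 ^ a i j`, so it maps `|F_i|` to a function of size `O(t)`, and each change is `O(t ‖F_{i+1} -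
F_i‖₁)`. The `F_i` are increasing restrictions of `f`, so these norms add up to at most `‖f‖₁`, the
total is `O(t ‖f‖₁)` (`sum_resolventEnergy_drop_le`), and Chebyshev concludes.

Boxes in arbitrary position are translated so that they all contain the origin, and the ergodic
statement follows by transference to orbits. -/

/-! ### Symbol estimates: interval averages against resolvents -/

/-- The mean of `u ^ m` over the interval `[l, l + 2 ^ a)`. -/
noncomputable def intervalSymbol (l : ℤ) (a : ℕ) (u : ℂ) : ℂ :=
  ((2 : ℂ) ^ a)⁻¹ * ∑ m ∈ Finset.Ico l (l + 2 ^ a), u ^ m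

/-- The ratio of the geometric kernel of width `2 ^ a`. -/
noncomputable def geomRatio (a : ℕ) : ℝ := 1 - ((2 : ℝ) ^ (a + 1))⁻¹

/-- The symbol `|(1 - ρ) (1 - ρ u)⁻¹| ^ 2` with `ρ = geomRatio a`. -/
noncomputable def resolventSymbol (a : ℕ) (u : ℂ) : ℝ :=
  (((2 : ℝ) ^ (a + 1))⁻¹) ^ 2 / ‖1 - (geomRatio a : ℂ) * u‖ ^ 2

/-- The exponent `a + 1` in place of `a` keeps the ratio positive at `a = 0`. -/
lemma geomRatio_pos (a : ℕ) : 0 < geomRatio a := by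
  have : (1 : ℝ) < 2 ^ (a + 1) := one_lt_pow₀ one_lt_two (Nat.succ_ne_zero a)
  have := inv_lt_one_of_one_lt₀ this
  unfold geomRatio; linarith

lemma geomRatio_lt_one (a : ℕ) : geomRatio a < 1 := by
  have : (0 : ℝ) < ((2 : ℝ) ^ (a + 1))⁻¹ := by positivity
  unfold geomRatio; linarith

lemma one_sub_geomRatio (a : ℕ) : 1 - geomRatio a = ((2 : ℝ) ^ (a + 1))⁻¹ := by
  unfold geomRatio; ring

lemma sq_norm_one_sub_mul (ρ : ℝ) {u : ℂ} (hu : ‖u‖ = 1) :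
    ‖1 - (ρ : ℂ) * u‖ ^ 2 = (1 - ρ) ^ 2 + ρ * ‖1 - u‖ ^ 2 := by
  have h1 : u.re * u.re + u.im * u.im = 1 := by
    have := Complex.normSq_apply u
    rw [Complex.normSq_eq_norm_sq, hu] at this
    linarith
  rw [← Complex.normSq_eq_norm_sq, ← Complex.normSq_eq_norm_sq, Complex.normSq_apply,
    Complex.normSq_apply]
  simp only [Complex.sub_re, Complex.one_re, Complex.mul_re, Complex.ofReal_re, Complex.ofReal_im,
    Complex.sub_im, Complex.one_im, Complex.mul_im]
  linear_combination (ρ ^ 2 - ρ) * h1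

lemma resolventSymbol_eq (a : ℕ) {u : ℂ} (hu : ‖u‖ = 1) :
    resolventSymbol a u = 1 / (1 + ((2 * 2 ^ a) ^ 2 - 2 * 2 ^ a) * ‖1 - u‖ ^ 2) := by
  have hM : (0 : ℝ) < 2 ^ a := by positivity
  have h1 : (1 : ℝ) ≤ 2 ^ a := one_le_pow₀ one_le_two
  have h2 : 0 ≤ ‖1 - u‖ ^ 2 := by positivity
  rw [resolventSymbol, sq_norm_one_sub_mul _ hu, one_sub_geomRatio, geomRatio, pow_succ (2 : ℝ) a]
  set M : ℝ := 2 ^ a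
  have h3 : 0 < 1 + ((2 * M) ^ 2 - 2 * M) * ‖1 - u‖ ^ 2 := by
    have : 0 ≤ ((2 * M) ^ 2 - 2 * M) * ‖1 - u‖ ^ 2 := mul_nonneg (by nlinarith) h2
    linarith
  have h4 : ((M * 2)⁻¹) ^ 2 + (1 - (M * 2)⁻¹) * ‖1 - u‖ ^ 2
      = ((M * 2)⁻¹) ^ 2 * (1 + ((2 * M) ^ 2 - 2 * M) * ‖1 - u‖ ^ 2) := by
    field_simp
  rw [h4]
  field_simp

lemma resolventSymbol_nonneg (a : ℕ) (u : ℂ) : 0 ≤ resolventSymbol a u := by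
  unfold resolventSymbol; positivity

lemma norm_intervalSymbol_le_one (l : ℤ) (a : ℕ) {u : ℂ} (hu : ‖u‖ = 1) :
    ‖intervalSymbol l a u‖ ≤ 1 := by
  have h : ‖∑ m ∈ Finset.Ico l (l + 2 ^ a), u ^ m‖ ≤ 2 ^ a := by
    refine (norm_sum_le _ _).trans ?_
    simp [norm_zpow, hu, Int.toNat_pow_of_nonneg]
  rw [intervalSymbol, norm_mul, norm_inv, norm_pow, Complex.norm_ofNat]
  rw [inv_mul_le_iff₀ (by positivity)]
  linarith

lemma sum_zpow_Ico_mul (u : ℂ) (hu : u ≠ 0) (l : ℤ) (n : ℕ) :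
    (∑ m ∈ Finset.Ico l (l + n), u ^ m) * (1 - u) = u ^ l - u ^ (l + n) := by
  induction n with
  | zero => simp
  | succ n ih =>
    have : Finset.Ico l (l + (n + 1 : ℕ)) = insert (l + n) (Finset.Ico l (l + n)) := by
      ext x; simp only [Finset.mem_Ico, Finset.mem_insert]; push_cast; omega
    rw [this, Finset.sum_insert (by simp), add_mul, ih]
    push_cast
    rw [← add_assoc, zpow_add₀ hu (l + n) 1, zpow_one]
    ring

lemma norm_intervalSymbol_mul_le (l : ℤ) (a : ℕ) {u : ℂ} (hu : ‖u‖ = 1) :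
    ‖intervalSymbol l a u‖ * (2 ^ a * ‖1 - u‖) ≤ 2 := by
  have hu0 : u ≠ 0 := by rintro rfl; simp at hu
  have h := sum_zpow_Ico_mul u hu0 l (2 ^ a)
  push_cast at h
  have h2 : ‖u ^ l - u ^ (l + 2 ^ a)‖ ≤ 2 := by
    refine (norm_sub_le _ _).trans ?_
    simp [norm_zpow, hu]; norm_num
  rw [← h, norm_mul] at h2
  rw [intervalSymbol, norm_mul, norm_inv, norm_pow, Complex.norm_ofNat]
  have : (0 : ℝ) < 2 ^ a := by positivity
  field_simp
  linarith

lemma norm_one_sub_zpow_le {u : ℂ} (hu : ‖u‖ = 1) (m : ℤ) :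
    ‖1 - u ^ m‖ ≤ |(m : ℝ)| * ‖1 - u‖ := by
  have hn : ∀ n : ℕ, ‖1 - u ^ n‖ ≤ n * ‖1 - u‖ := by
    intro n
    induction n with
    | zero => simp
    | succ n ih =>
      have : 1 - u ^ (n + 1) = (1 - u ^ n) + u ^ n * (1 - u) := by ring
      rw [this]
      refine (norm_add_le _ _).trans ?_
      rw [norm_mul, norm_pow, hu, one_pow]
      push_cast
      linarith
  have hu0 : u ≠ 0 := by rintro rfl; simp at hu
  obtain ⟨n, rfl | rfl⟩ := m.eq_nat_or_neg
  · simpa using hn n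
  · have : 1 - u ^ (-(n : ℤ)) = - (u ^ (-(n : ℤ)) * (1 - u ^ n)) := by
      rw [zpow_neg, zpow_natCast]
      have := pow_ne_zero n hu0
      field_simp
      ring
    rw [this, norm_neg, norm_mul, norm_zpow, hu, one_zpow, one_mul]
    simpa using hn n

/-- An interval that contains the origin has all its points in `|m| ≤ 2 ^ a`. This is where the
position of the interval matters. -/
lemma norm_one_sub_intervalSymbol_le {l : ℤ} {a : ℕ} (h0 : l ≤ 0) (h1 : 0 < l + 2 ^ a) {u : ℂ}
    (hu : ‖u‖ = 1) : ‖1 - intervalSymbol l a u‖ ≤ 2 ^ a * ‖1 - u‖ := by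
  have hM : (0 : ℝ) < 2 ^ a := by positivity
  have h : 1 - intervalSymbol l a u
      = ((2 : ℂ) ^ a)⁻¹ * ∑ m ∈ Finset.Ico l (l + 2 ^ a), (1 - u ^ m) := by
    rw [Finset.sum_sub_distrib, mul_sub, intervalSymbol]
    simp [Int.toNat_pow_of_nonneg]
  have h2 : ‖∑ m ∈ Finset.Ico l (l + 2 ^ a), (1 - u ^ m)‖ ≤ 2 ^ a * (2 ^ a * ‖1 - u‖) := by
    refine (norm_sum_le_of_le _ (f := fun m : ℤ => 1 - u ^ m) (fun m hm => ?_)).trans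
      (b := ∑ m ∈ Finset.Ico l (l + 2 ^ a), 2 ^ a * ‖1 - u‖) ?_
    · refine (norm_one_sub_zpow_le hu m).trans ?_
      gcongr
      rw [Finset.mem_Ico] at hm
      have : |m| ≤ 2 ^ a := by rw [abs_le]; constructor <;> linarith
      exact_mod_cast this
    · simp [Int.toNat_pow_of_nonneg]
  rw [h, norm_mul, norm_inv, norm_pow, Complex.norm_ofNat, inv_mul_le_iff₀ hM]
  exact h2

/-- With `x` the norm of the symbol, `x ≤ 1` and `x M |1 - u| ≤ 2` give `x² (1 + 4 M² |1 - u|²) ≤ 1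
+ 16`. -/
lemma sq_norm_intervalSymbol_le (l : ℤ) (a : ℕ) {u : ℂ} (hu : ‖u‖ = 1) :
    ‖intervalSymbol l a u‖ ^ 2 ≤ 17 * resolventSymbol a u := by
  have h1 := norm_intervalSymbol_le_one l a hu
  have h2 := norm_intervalSymbol_mul_le l a hu
  have h0 := norm_nonneg (intervalSymbol l a u)
  have hM : (1 : ℝ) ≤ 2 ^ a := one_le_pow₀ one_le_two
  rw [resolventSymbol_eq a hu]
  set x := ‖intervalSymbol l a u‖
  set w := ‖1 - u‖
  set M : ℝ := 2 ^ a
  have hw : 0 ≤ w := norm_nonneg _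
  have h3 : 0 ≤ ((2 * M) ^ 2 - 2 * M) * w ^ 2 := mul_nonneg (by nlinarith) (by positivity)
  rw [mul_one_div, le_div_iff₀ (by linarith)]
  have h4 : (x * (M * w)) ^ 2 ≤ 2 ^ 2 := pow_le_pow_left₀ (by positivity) h2 2
  have h5 : x ^ 2 ≤ 1 := by nlinarith
  have h6 : 0 ≤ x ^ 2 * (2 * M) * w ^ 2 := by positivity
  nlinarith

/-- Here `X` and `Y` stand for `(N |1 - u|)²` and `(M |1 - u|)²`. Expanding `z (1 + 4 Y) (1 + 4 X)`
bounds it by `(4 + 16 + 16 + 256) X = 292 X`, and `2 X ≤ t - s` halves the constant. -/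
lemma le_mul_one_div_sub_one_div {z X Y s t : ℝ} (hz : 0 ≤ z) (hY : 0 ≤ Y) (f1 : z ≤ 4 * X)
    (f2 : z ≤ 4) (f3 : z * Y ≤ 16) (hYX : Y ≤ X) (hs : 0 ≤ s) (ht : 0 ≤ t) (hs1 : s ≤ 4 * Y)
    (ht1 : t ≤ 4 * X) (hst : 2 * X ≤ t - s) :
    z ≤ 146 * (1 / (1 + s) - 1 / (1 + t)) := by
  have hX : 0 ≤ X := hY.trans hYX
  have key : z * ((1 + s) * (1 + t)) ≤ 146 * (t - s) := by
    have g1 : (1 + s) * (1 + t) ≤ (1 + 4 * Y) * (1 + 4 * X) := by gcongr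
    have g3 := mul_le_mul_of_nonneg_left g1 hz
    have g4 : z * Y ≤ 4 * Y := mul_le_mul_of_nonneg_right f2 hY
    have g5 : z * X ≤ 4 * X := mul_le_mul_of_nonneg_right f2 hX
    have g6 : z * Y * X ≤ 16 * X := mul_le_mul_of_nonneg_right f3 hX
    linarith
  have : 1 / (1 + s) - 1 / (1 + t) = (t - s) / ((1 + s) * (1 + t)) := by
    field_simp; ring
  rw [this, ← mul_div_assoc, le_div_iff₀ (by positivity)]
  exact key

/-- Both symbols are close to 1 at low frequencies and small at high ones. The doubling `2 * 2 ^ a ≤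
2 ^ b` makes the gap between the resolvents comparable to the larger scale. -/
lemma sq_norm_intervalSymbol_sub_le {l l' : ℤ} {a b : ℕ} (hab : a < b) (h0 : l ≤ 0)
    (h1 : 0 < l + 2 ^ a) (h0' : l' ≤ 0) (h1' : 0 < l' + 2 ^ b) {u : ℂ} (hu : ‖u‖ = 1) :
    ‖intervalSymbol l a u - intervalSymbol l' b u‖ ^ 2
      ≤ 146 * (resolventSymbol a u - resolventSymbol b u) := by
  have ha := norm_intervalSymbol_le_one l a hu
  have hb := norm_intervalSymbol_le_one l' b hu
  have ha2 := norm_intervalSymbol_mul_le l a hu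
  have hb2 := norm_intervalSymbol_mul_le l' b hu
  have ha3 := norm_one_sub_intervalSymbol_le h0 h1 hu
  have hb3 := norm_one_sub_intervalSymbol_le h0' h1' hu
  have hM : (1 : ℝ) ≤ 2 ^ a := one_le_pow₀ one_le_two
  have hMM : (2 : ℝ) * 2 ^ a ≤ 2 ^ b := by
    rw [← pow_succ']; exact pow_le_pow_right₀ one_le_two hab
  have hw : 0 ≤ ‖1 - u‖ := norm_nonneg _
  have hx0 : 0 ≤ ‖intervalSymbol l a u - intervalSymbol l' b u‖ := norm_nonneg _
  have hx1 : ‖intervalSymbol l a u - intervalSymbol l' b u‖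
      ≤ ‖intervalSymbol l a u‖ + ‖intervalSymbol l' b u‖ := norm_sub_le _ _
  have hx2 : ‖intervalSymbol l a u - intervalSymbol l' b u‖
      ≤ ‖1 - intervalSymbol l a u‖ + ‖1 - intervalSymbol l' b u‖ := by
    rw [norm_sub_rev (1 : ℂ) (intervalSymbol l a u)]
    simpa using norm_sub_le_norm_sub_add_norm_sub (intervalSymbol l a u) 1 (intervalSymbol l' b u)
  have hpb := norm_nonneg (intervalSymbol l' b u)
  rw [resolventSymbol_eq a hu, resolventSymbol_eq b hu]
  set x := ‖intervalSymbol l a u - intervalSymbol l' b u‖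
  set p := ‖intervalSymbol l a u‖
  set q := ‖intervalSymbol l' b u‖
  set w := ‖1 - u‖
  set M : ℝ := 2 ^ a
  set N : ℝ := 2 ^ b
  have e1 : x ≤ 2 * (N * w) := by nlinarith
  have e2 : x * (M * w) ≤ 4 := by
    have : q * (M * w) ≤ q * (N * w) := by gcongr; linarith
    have : x * (M * w) ≤ (p + q) * (M * w) := by gcongr
    linarith
  have f1 : x ^ 2 ≤ 4 * (N * w) ^ 2 := by
    have := pow_le_pow_left₀ hx0 e1 2
    nlinarith
  have f2 : x ^ 2 ≤ 4 := by
    have := pow_le_pow_left₀ hx0 (show x ≤ 2 by linarith) 2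
    linarith
  have f3 : x ^ 2 * (M * w) ^ 2 ≤ 16 := by
    have := pow_le_pow_left₀ (by positivity) e2 2
    nlinarith
  have g2 : (M * w) ^ 2 ≤ (N * w) ^ 2 := by gcongr; linarith
  have hs0 : 0 ≤ ((2 * M) ^ 2 - 2 * M) * w ^ 2 := mul_nonneg (by nlinarith) (by positivity)
  have ht0 : 0 ≤ ((2 * N) ^ 2 - 2 * N) * w ^ 2 := mul_nonneg (by nlinarith) (by positivity)
  have hs1 : ((2 * M) ^ 2 - 2 * M) * w ^ 2 ≤ 4 * (M * w) ^ 2 := by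
    have : 0 ≤ 2 * M * w ^ 2 := by positivity
    linarith
  have ht1 : ((2 * N) ^ 2 - 2 * N) * w ^ 2 ≤ 4 * (N * w) ^ 2 := by
    have : 0 ≤ 2 * N * w ^ 2 := by positivity
    linarith
  have hst : 2 * (N * w) ^ 2
      ≤ ((2 * N) ^ 2 - 2 * N) * w ^ 2 - ((2 * M) ^ 2 - 2 * M) * w ^ 2 := by
    have : 2 * N ^ 2 ≤ ((2 * N) ^ 2 - 2 * N) - ((2 * M) ^ 2 - 2 * M) := by nlinarith
    have := mul_le_mul_of_nonneg_right this (sq_nonneg w)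
    linarith
  exact le_mul_one_div_sub_one_div (sq_nonneg x) (sq_nonneg _) f1 f2 f3 g2 hs0 ht0 hs1 ht1 hst

/-- Change one factor at a time: `m P - m' P' = (m - m') P + m' (P - P')` matches `r R - r' R' = (r
- r') R + r' (R - R')`. Squaring the sum costs a factor 2 per step, whence `292 = 2 * 146` and `34 =
2 * 17`. -/
lemma sq_norm_prod_sub_prod_le {ι : Type*} (s : Finset ι) (m m' : ι → ℂ) (r r' : ι → ℝ)
    (h0 : ∀ j ∈ s, 0 ≤ r' j) (h1 : ∀ j ∈ s, r' j ≤ r j)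
    (hm : ∀ j ∈ s, ‖m j‖ ^ 2 ≤ 17 * r j)
    (hm' : ∀ j ∈ s, ‖m' j‖ ^ 2 ≤ 17 * r' j)
    (hd : ∀ j ∈ s, ‖m j - m' j‖ ^ 2 ≤ 146 * (r j - r' j)) :
    ‖∏ j ∈ s, m j - ∏ j ∈ s, m' j‖ ^ 2
      ≤ 292 * 34 ^ s.card * (∏ j ∈ s, r j - ∏ j ∈ s, r' j) := by
  classical
  induction s using Finset.induction_on with
  | empty => simp
  | insert j s hj ih =>
    have ih := ih (fun i hi => h0 i (by simp [hi])) (fun i hi => h1 i (by simp [hi]))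
      (fun i hi => hm i (by simp [hi])) (fun i hi => hm' i (by simp [hi]))
      (fun i hi => hd i (by simp [hi]))
    have hP : ‖∏ i ∈ s, m i‖ ^ 2 ≤ 17 ^ s.card * ∏ i ∈ s, r i := by
      rw [norm_prod, ← Finset.prod_pow, ← Finset.prod_const, ← Finset.prod_mul_distrib]
      exact Finset.prod_le_prod (fun _ _ => by positivity) fun i hi => hm i (by simp [hi])
    have hR : ∏ i ∈ s, r' i ≤ ∏ i ∈ s, r i :=
      Finset.prod_le_prod (fun i hi => h0 i (by simp [hi])) fun i hi => h1 i (by simp [hi])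
    have hR0 : 0 ≤ ∏ i ∈ s, r' i := Finset.prod_nonneg fun i hi => h0 i (by simp [hi])
    have a0 := h0 j (by simp)
    have a1 := h1 j (by simp)
    have a2 := hm' j (by simp)
    have a3 := hd j (by simp)
    rw [Finset.prod_insert hj, Finset.prod_insert hj, Finset.prod_insert hj, Finset.prod_insert hj,
      Finset.card_insert_of_notMem hj]
    set P := ∏ i ∈ s, m i
    set P' := ∏ i ∈ s, m' i
    set R := ∏ i ∈ s, r i
    set R' := ∏ i ∈ s, r' i
    have e : m j * P - m' j * P' = (m j - m' j) * P + m' j * (P - P') := by ring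
    have e1 : ‖m j * P - m' j * P'‖ ≤ ‖m j - m' j‖ * ‖P‖ + ‖m' j‖ * ‖P - P'‖ := by
      rw [e, ← norm_mul, ← norm_mul]; exact norm_add_le _ _
    have e2 : ‖m j * P - m' j * P'‖ ^ 2
        ≤ 2 * (‖m j - m' j‖ ^ 2 * ‖P‖ ^ 2) + 2 * (‖m' j‖ ^ 2 * ‖P - P'‖ ^ 2) := by
      have := pow_le_pow_left₀ (norm_nonneg _) e1 2
      nlinarith [sq_nonneg (‖m j - m' j‖ * ‖P‖ - ‖m' j‖ * ‖P - P'‖)]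
    have e3 : ‖m j - m' j‖ ^ 2 * ‖P‖ ^ 2 ≤ (146 * (r j - r' j)) * (34 ^ s.card * R) := by
      refine mul_le_mul a3 (hP.trans ?_) (by positivity) (by linarith)
      have : 0 ≤ R := hR0.trans hR
      gcongr
      norm_num
    have e4 : ‖m' j‖ ^ 2 * ‖P - P'‖ ^ 2 ≤ (17 * r' j) * (292 * 34 ^ s.card * (R - R')) :=
      mul_le_mul a2 ih (by positivity) (by linarith)
    refine e2.trans ?_
    have e5 : 0 ≤ 34 ^ s.card * ((r j - r' j) * R) :=
      mul_nonneg (by positivity) (mul_nonneg (by linarith) (hR0.trans hR))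
    rw [pow_succ (34 : ℝ)]
    linarith

/-! ### Fourier coefficients of the resolvent symbol on the circle -/

/-- The standard unimodular coordinate on `ℝ / ℤ`. -/
noncomputable def circleCoord (x : AddCircle (1 : ℝ)) : ℂ := (AddCircle.toCircle x : ℂ)

lemma norm_circleCoord (x : AddCircle (1 : ℝ)) : ‖circleCoord x‖ = 1 := Circle.norm_coe _

lemma circleCoord_ne_zero (x : AddCircle (1 : ℝ)) : circleCoord x ≠ 0 := Circle.coe_ne_zero _

lemma continuous_circleCoord : Continuous circleCoord :=
  continuous_subtype_val.comp AddCircle.continuous_toCircle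

lemma continuous_circleCoord_zpow (v : ℤ) : Continuous fun x => circleCoord x ^ v :=
  continuous_circleCoord.zpow₀ v fun x => Or.inl (circleCoord_ne_zero x)

lemma conj_circleCoord (x : AddCircle (1 : ℝ)) :
    (starRingEnd ℂ) (circleCoord x) = (circleCoord x)⁻¹ := by
  rw [circleCoord, ← Circle.coe_inv, Circle.coe_inv_eq_conj]

lemma Continuous.integrable_of_compactSpace {X E : Type*} [TopologicalSpace X] [CompactSpace X]
    [T2Space X]
    [MeasurableSpace X] [OpensMeasurableSpace X] [NormedAddCommGroup E]
    [SecondCountableTopologyEither X E]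
    {μ : Measure X} [IsFiniteMeasureOnCompacts μ] {f : X → E} (hf : Continuous f) :
    Integrable f μ := by
  simpa using hf.continuousOn.integrableOn_compact (μ := μ) (K := Set.univ) isCompact_univ

/-- The Haar probability measure on `ℝ / ℤ`. -/
noncomputable abbrev circleMeasure : Measure (AddCircle (1 : ℝ)) := AddCircle.haarAddCircle

lemma integral_circleCoord_zpow (v : ℤ) :
    ∫ x, circleCoord x ^ v ∂circleMeasure = if v = 0 then 1 else 0 := by
  have e : ∀ x : AddCircle (1 : ℝ), circleCoord x ^ v = fourier v x := by
    intro x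
    rw [fourier_apply, AddCircle.toCircle_zsmul, Circle.coe_zpow, circleCoord]
  simp_rw [e]
  split_ifs with h
  · subst h; simp
  · exact integral_eq_zero_of_add_right_eq_neg (fourier_add_half_inv_index h one_pos)

lemma one_sub_mul_circleCoord_ne_zero {ρ : ℝ} (h0 : 0 < ρ) (h1 : ρ < 1) (x : AddCircle (1 : ℝ)) :
    1 - (ρ : ℂ) * circleCoord x ≠ 0 := by
  intro h
  have h2 : ‖(ρ : ℂ) * circleCoord x‖ = 1 := by
    rw [← sub_eq_zero.1 h, norm_one]
  rw [norm_mul, norm_circleCoord, Complex.norm_real, Real.norm_of_nonneg h0.le] at h2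
  linarith

lemma one_sub_le_norm_one_sub_mul_circleCoord {ρ : ℝ} (h0 : 0 < ρ) (x : AddCircle (1 : ℝ)) :
    1 - ρ ≤ ‖1 - (ρ : ℂ) * circleCoord x‖ := by
  have h := norm_sub_norm_le (1 : ℂ) ((ρ : ℂ) * circleCoord x)
  rwa [norm_one, norm_mul, norm_circleCoord, mul_one, Complex.norm_real,
    Real.norm_of_nonneg h0.le] at h

lemma continuous_circleCoord_zpow_div {ρ : ℝ} (h0 : 0 < ρ) (h1 : ρ < 1) (v : ℤ) :
    Continuous fun x => circleCoord x ^ v / (1 - (ρ : ℂ) * circleCoord x) :=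
  (continuous_circleCoord_zpow v).div (continuous_const.sub
    (continuous_const.mul continuous_circleCoord)) (one_sub_mul_circleCoord_ne_zero h0 h1)

lemma integral_zpow_div_one_sub {ρ : ℝ} (h0 : 0 < ρ) (h1 : ρ < 1) (v : ℤ) :
    ∫ x, circleCoord x ^ v / (1 - (ρ : ℂ) * circleCoord x) ∂circleMeasure
      = (if v = 0 then 1 else 0)
        + ρ * ∫ x, circleCoord x ^ (v + 1) / (1 - (ρ : ℂ) * circleCoord x) ∂circleMeasure := by
  rw [← integral_circleCoord_zpow, ← integral_const_mul, ← integral_add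
    (continuous_circleCoord_zpow v).integrable_of_compactSpace
    ((continuous_circleCoord_zpow_div h0 h1 _).integrable_of_compactSpace.const_mul _)]
  congr 1
  ext x
  have := one_sub_mul_circleCoord_ne_zero h0 h1 x
  rw [zpow_add₀ (circleCoord_ne_zero x), zpow_one]
  field_simp
  ring

/-- Iterating the recursion gives `g v = ρ ^ n * g (v + n)` with `g` bounded, so `g v = 0`; no
series expansion is needed. -/
lemma integral_zpow_div_one_sub_of_pos {ρ : ℝ} (h0 : 0 < ρ) (h1 : ρ < 1) {v : ℤ} (hv : 0 < v) :
    ∫ x, circleCoord x ^ v / (1 - (ρ : ℂ) * circleCoord x) ∂circleMeasure = 0 := by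
  set g : ℤ → ℂ := fun v => ∫ x, circleCoord x ^ v / (1 - (ρ : ℂ) * circleCoord x) ∂circleMeasure with hg
  have hb : ∀ v, ‖g v‖ ≤ (1 - ρ)⁻¹ := by
    intro v
    refine (norm_integral_le_of_norm_le_const (C := (1 - ρ)⁻¹)
      (Filter.Eventually.of_forall fun x => ?_)).trans ?_
    · rw [norm_div, norm_zpow, norm_circleCoord, one_zpow, one_div]
      exact inv_anti₀ (by linarith) (one_sub_le_norm_one_sub_mul_circleCoord h0 x)
    · simp
  have hr : ∀ n : ℕ, g v = ρ ^ n * g (v + n) := by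
    intro n
    induction n with
    | zero => simp
    | succ n ih =>
      rw [ih]
      simp only [hg]
      rw [integral_zpow_div_one_sub h0 h1, if_neg (by omega)]
      push_cast
      ring_nf
  have hl : Filter.Tendsto (fun n : ℕ => ρ ^ n * (1 - ρ)⁻¹) Filter.atTop (nhds 0) := by
    simpa using (tendsto_pow_atTop_nhds_zero_of_lt_one h0.le h1).mul_const _
  have : ‖g v‖ ≤ 0 := by
    refine ge_of_tendsto' hl fun n => ?_
    rw [hr n, norm_mul, norm_pow, Complex.norm_real, Real.norm_of_nonneg h0.le]
    exact mul_le_mul_of_nonneg_left (hb _) (by positivity)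
  exact norm_le_zero_iff.1 this

lemma integral_zpow_zero_div_one_sub {ρ : ℝ} (h0 : 0 < ρ) (h1 : ρ < 1) :
    ∫ x, circleCoord x ^ (0 : ℤ) / (1 - (ρ : ℂ) * circleCoord x) ∂circleMeasure = 1 := by
  rw [integral_zpow_div_one_sub h0 h1, integral_zpow_div_one_sub_of_pos h0 h1 (by norm_num)]
  simp

lemma continuous_resolventSymbol (a : ℕ) : Continuous fun x => resolventSymbol a (circleCoord x) := by
  refine continuous_const.div ((continuous_const.sub
    (continuous_const.mul continuous_circleCoord)).norm.pow 2) fun x => ?_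
  exact pow_ne_zero _ (norm_ne_zero_iff.2
    (one_sub_mul_circleCoord_ne_zero (geomRatio_pos a) (geomRatio_lt_one a) x))

/-- On the circle `|1 - ρ u|² = (1 - ρ u) (1 - ρ u⁻¹)`; clearing one factor yields a first-order
recursion for the Fourier coefficients. -/
lemma resolventSymbol_mul (a : ℕ) (x : AddCircle (1 : ℝ)) :
    (resolventSymbol a (circleCoord x) : ℂ) * (1 - geomRatio a * (circleCoord x)⁻¹)
      = (1 - geomRatio a) ^ 2 / (1 - geomRatio a * circleCoord x) := by
  have h := one_sub_mul_circleCoord_ne_zero (geomRatio_pos a) (geomRatio_lt_one a) x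
  have h2 : ((‖1 - (geomRatio a : ℂ) * circleCoord x‖ ^ 2 : ℝ) : ℂ)
      = (1 - geomRatio a * circleCoord x) * (1 - geomRatio a * (circleCoord x)⁻¹) := by
    push_cast
    rw [← Complex.mul_conj']
    simp [conj_circleCoord]
  have h3 : 1 - (geomRatio a : ℂ) * (circleCoord x)⁻¹ ≠ 0 := by
    intro h0
    rw [h0, mul_zero] at h2
    have : ‖1 - (geomRatio a : ℂ) * circleCoord x‖ ^ 2 = 0 := by exact_mod_cast h2
    exact h (norm_eq_zero.1 (by simpa using this))
  rw [resolventSymbol, ← one_sub_geomRatio, Complex.ofReal_div, h2]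
  push_cast
  rw [div_mul_eq_mul_div, mul_div_mul_right _ _ h3]

lemma integral_resolventSymbol_mul_zpow (a : ℕ) (v : ℤ) :
    ∫ x, (resolventSymbol a (circleCoord x) : ℂ) * circleCoord x ^ v ∂circleMeasure
      = geomRatio a * ∫ x, (resolventSymbol a (circleCoord x) : ℂ) * circleCoord x ^ (v - 1) ∂circleMeasure
        + (1 - geomRatio a) ^ 2
          * ∫ x, circleCoord x ^ v / (1 - (geomRatio a : ℂ) * circleCoord x) ∂circleMeasure := by
  have c1 : ∀ v : ℤ, Continuous fun x =>
      (resolventSymbol a (circleCoord x) : ℂ) * circleCoord x ^ v := fun v =>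
    (Complex.continuous_ofReal.comp (continuous_resolventSymbol a)).mul
      (continuous_circleCoord_zpow v)
  rw [← integral_const_mul, ← integral_const_mul, ← integral_add
    ((c1 _).integrable_of_compactSpace.const_mul _)
    ((continuous_circleCoord_zpow_div (geomRatio_pos a)
      (geomRatio_lt_one a) _).integrable_of_compactSpace.const_mul _)]
  congr 1
  ext x
  have h := resolventSymbol_mul a x
  rw [zpow_sub₀ (circleCoord_ne_zero x), zpow_one]
  linear_combination circleCoord x ^ v * h

lemma integral_resolventSymbol_mul_zpow_neg (a : ℕ) (v : ℤ) :
    ∫ x, (resolventSymbol a (circleCoord x) : ℂ) * circleCoord x ^ (-v) ∂circleMeasure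
      = (starRingEnd ℂ) (∫ x, (resolventSymbol a (circleCoord x) : ℂ) * circleCoord x ^ v ∂circleMeasure) := by
  rw [← integral_conj]
  congr 1
  ext x
  rw [map_mul, Complex.conj_ofReal, map_zpow₀, conj_circleCoord, inv_zpow, zpow_neg]

/-- For `v > 0` the recursion has no source term, so the coefficients decay with ratio `ρ`;
conjugation covers `v < 0`. At `v = 0` it gives `‖h 0‖ (1 + ρ) ≤ 1 - ρ`, while `2 (1 - ρ) = 2 ^
(-a)`. -/
lemma norm_integral_resolventSymbol_mul_zpow_le (a : ℕ) (v : ℤ) :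
    ‖∫ x, (resolventSymbol a (circleCoord x) : ℂ) * circleCoord x ^ v ∂circleMeasure‖
      ≤ ((2 : ℝ) ^ a)⁻¹ * geomRatio a ^ v.natAbs := by
  set h : ℤ → ℂ := fun v => ∫ x, (resolventSymbol a (circleCoord x) : ℂ) * circleCoord x ^ v ∂circleMeasure
    with hh
  have p0 := geomRatio_pos a
  have p1 := geomRatio_lt_one a
  have r : ∀ n : ℕ, ‖h n‖ = geomRatio a ^ n * ‖h 0‖ := by
    intro n
    induction n with
    | zero => simp
    | succ n ih =>
      have := integral_resolventSymbol_mul_zpow a (n + 1 : ℕ)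
      rw [integral_zpow_div_one_sub_of_pos p0 p1 (by positivity)] at this
      simp only [hh] at ih ⊢
      rw [this, mul_zero, add_zero, norm_mul, Complex.norm_real, Real.norm_of_nonneg p0.le]
      push_cast
      rw [add_sub_cancel_right, ih, pow_succ]
      ring
  have hneg : ∀ v, ‖h (-v)‖ = ‖h v‖ := by
    intro v
    simp only [hh]
    rw [integral_resolventSymbol_mul_zpow_neg, RCLike.norm_conj]
  have z : ‖h 0‖ ≤ ((2 : ℝ) ^ a)⁻¹ := by
    have e := integral_resolventSymbol_mul_zpow a 0
    rw [integral_zpow_zero_div_one_sub p0 p1] at e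
    have e2 : ‖h 0‖ ≤ geomRatio a * ‖h (-1)‖ + (1 - geomRatio a) ^ 2 := by
      have : h 0 = geomRatio a * h (-1) + (1 - geomRatio a) ^ 2 := by
        simpa [hh] using e
      rw [this]
      refine (norm_add_le _ _).trans (le_of_eq ?_)
      rw [norm_mul, norm_pow, ← Complex.ofReal_one, ← Complex.ofReal_sub, Complex.norm_real,
        Complex.norm_real, Real.norm_of_nonneg p0.le, Real.norm_of_nonneg (by linarith)]
    have e3 : ‖h (-1)‖ = geomRatio a * ‖h 0‖ := by
      rw [hneg]; simpa using r 1
    rw [e3] at e2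
    have e4 : ((2 : ℝ) ^ a)⁻¹ = 2 * (1 - geomRatio a) := by
      rw [one_sub_geomRatio, pow_succ]; field_simp
    rw [e4]
    have : ‖h 0‖ * (1 + geomRatio a) ≤ 1 - geomRatio a := by
      have : (‖h 0‖ * (1 + geomRatio a)) * (1 - geomRatio a) ≤ (1 - geomRatio a) * (1 - geomRatio a) := by
        linarith
      exact le_of_mul_le_mul_right this (by linarith)
    have := mul_nonneg (norm_nonneg (h 0)) p0.le
    linarith
  have fin : ‖h v‖ = geomRatio a ^ v.natAbs * ‖h 0‖ := by
    rcases Int.natAbs_eq v with e | e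
    · conv_lhs => rw [e]
      exact r _
    · conv_lhs => rw [e, hneg]
      exact r _
  change ‖h v‖ ≤ _
  rw [fin, mul_comm]
  exact mul_le_mul_of_nonneg_right z (by positivity)

/-! ### Parseval on the torus and the resolvent energy -/

/-- The Haar probability measure on the torus. -/
noncomputable abbrev torusMeasure (d : ℕ) : Measure (Fin d → AddCircle (1 : ℝ)) :=
  Measure.pi fun _ => circleMeasure

/-- The character of the torus with frequency `n`. -/
noncomputable def torusChar {d : ℕ} (n : Fin d → ℤ) (θ : Fin d → AddCircle (1 : ℝ)) : ℂ :=
  ∏ j, circleCoord (θ j) ^ n j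

/-- The trigonometric polynomial with coefficients `F` on `S`. -/
noncomputable def trigSum {d : ℕ} (S : Finset (Fin d → ℤ)) (F : (Fin d → ℤ) → ℂ)
    (θ : Fin d → AddCircle (1 : ℝ)) : ℂ :=
  ∑ x ∈ S, F x * torusChar x θ

/-- The symbol of the average over the box with corner `l` and sides `2 ^ a`. -/
noncomputable def boxSymbol {d : ℕ} (l : Fin d → ℤ) (a : Fin d → ℕ)
    (θ : Fin d → AddCircle (1 : ℝ)) : ℂ :=
  ∏ j, intervalSymbol (l j) (a j) (circleCoord (θ j))

/-- The product of the resolvent symbols of widths `2 ^ a j`. -/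
noncomputable def boxResolvent {d : ℕ} (a : Fin d → ℕ) (θ : Fin d → AddCircle (1 : ℝ)) : ℝ :=
  ∏ j, resolventSymbol (a j) (circleCoord (θ j))

/-- The product of the normalized geometric kernels of widths `2 ^ a j`. -/
noncomputable def geomKernel {d : ℕ} (a : Fin d → ℕ) (v : Fin d → ℤ) : ℝ :=
  ∏ j, ((2 : ℝ) ^ a j)⁻¹ * geomRatio (a j) ^ (v j).natAbs

/-- The quadratic form of the product resolvent. -/
noncomputable def resolventEnergy {d : ℕ} (a : Fin d → ℕ) (S : Finset (Fin d → ℤ))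
    (F : (Fin d → ℤ) → ℂ) : ℝ :=
  ∫ θ, boxResolvent a θ * ‖trigSum S F θ‖ ^ 2 ∂torusMeasure d

section
variable {d : ℕ}

lemma continuous_torusChar (n : Fin d → ℤ) : Continuous (torusChar n) :=
  continuous_finsetProd _ fun j _ => (continuous_circleCoord_zpow (n j)).comp (continuous_apply j)

lemma continuous_trigSum (S : Finset (Fin d → ℤ)) (F : (Fin d → ℤ) → ℂ) :
    Continuous (trigSum S F) :=
  continuous_finsetSum _ fun x _ => continuous_const.mul (continuous_torusChar x)

lemma continuous_boxResolvent (a : Fin d → ℕ) : Continuous (boxResolvent a) :=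
  continuous_finsetProd _ fun j _ => (continuous_resolventSymbol (a j)).comp (continuous_apply j)

lemma boxResolvent_nonneg (a : Fin d → ℕ) (θ : Fin d → AddCircle (1 : ℝ)) :
    0 ≤ boxResolvent a θ :=
  Finset.prod_nonneg fun _ _ => resolventSymbol_nonneg _ _

lemma geomKernel_nonneg (a : Fin d → ℕ) (v : Fin d → ℤ) : 0 ≤ geomKernel a v :=
  Finset.prod_nonneg fun j _ => mul_nonneg (by positivity) (pow_nonneg (geomRatio_pos _).le _)

lemma torusChar_add (m n : Fin d → ℤ) (θ : Fin d → AddCircle (1 : ℝ)) :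
    torusChar (m + n) θ = torusChar m θ * torusChar n θ := by
  simp only [torusChar, Pi.add_apply, ← Finset.prod_mul_distrib]
  exact Finset.prod_congr rfl fun j _ => zpow_add₀ (circleCoord_ne_zero _) _ _

lemma conj_torusChar (n : Fin d → ℤ) (θ : Fin d → AddCircle (1 : ℝ)) :
    (starRingEnd ℂ) (torusChar n θ) = torusChar (-n) θ := by
  simp only [torusChar, map_prod, map_zpow₀, conj_circleCoord, Pi.neg_apply, inv_zpow, zpow_neg]

lemma integral_torusChar (n : Fin d → ℤ) :
    ∫ θ, torusChar n θ ∂torusMeasure d = if n = 0 then 1 else 0 := by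
  simp only [torusChar]
  rw [integral_fintype_prod_eq_prod (fun j x => circleCoord x ^ n j)]
  simp only [integral_circleCoord_zpow]
  split_ifs with h
  · subst h; simp
  · obtain ⟨j, hj⟩ := Function.ne_iff.1 h
    exact Finset.prod_eq_zero (Finset.mem_univ j) (by simpa using hj)

lemma norm_integral_boxResolvent_mul_torusChar_le (a : Fin d → ℕ) (v : Fin d → ℤ) :
    ‖∫ θ, (boxResolvent a θ : ℂ) * torusChar v θ ∂torusMeasure d‖ ≤ geomKernel a v := by
  simp only [boxResolvent, torusChar, Complex.ofReal_prod, ← Finset.prod_mul_distrib]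
  rw [integral_fintype_prod_eq_prod
    (fun j x => (resolventSymbol (a j) (circleCoord x) : ℂ) * circleCoord x ^ v j), norm_prod]
  exact Finset.prod_le_prod (fun _ _ => norm_nonneg _) fun j _ =>
    norm_integral_resolventSymbol_mul_zpow_le (a j) (v j)

lemma integral_mul_trigSum_mul_conj (r : (Fin d → AddCircle (1 : ℝ)) → ℂ) (hr : Continuous r)
    (S S' : Finset (Fin d → ℤ)) (F F' : (Fin d → ℤ) → ℂ) :
    ∫ θ, r θ * (trigSum S F θ * (starRingEnd ℂ) (trigSum S' F' θ)) ∂torusMeasure d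
      = ∑ x ∈ S, ∑ y ∈ S', F x * (starRingEnd ℂ) (F' y)
          * ∫ θ, r θ * torusChar (x - y) θ ∂torusMeasure d := by
  have e : ∀ θ, r θ * (trigSum S F θ * (starRingEnd ℂ) (trigSum S' F' θ))
      = ∑ x ∈ S, ∑ y ∈ S', F x * (starRingEnd ℂ) (F' y) * (r θ * torusChar (x - y) θ) := by
    intro θ
    rw [trigSum, trigSum, map_sum, Finset.sum_mul_sum, Finset.mul_sum]
    refine Finset.sum_congr rfl fun x _ => ?_
    rw [Finset.mul_sum]
    refine Finset.sum_congr rfl fun y _ => ?_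
    rw [map_mul, conj_torusChar, sub_eq_add_neg, torusChar_add]
    ring
  have c : ∀ v, Integrable (fun θ => r θ * torusChar v θ) (torusMeasure d) := fun v =>
    (hr.mul (continuous_torusChar v)).integrable_of_compactSpace
  simp_rw [e]
  rw [integral_finsetSum _ fun x _ => integrable_finsetSum _ fun y _ => (c _).const_mul _]
  refine Finset.sum_congr rfl fun x _ => ?_
  rw [integral_finsetSum _ fun y _ => (c _).const_mul _]
  exact Finset.sum_congr rfl fun y _ => integral_const_mul _ _

lemma integral_sq_norm_trigSum (S : Finset (Fin d → ℤ)) (F : (Fin d → ℤ) → ℂ) :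
    ∫ θ, ‖trigSum S F θ‖ ^ 2 ∂torusMeasure d = ∑ x ∈ S, ‖F x‖ ^ 2 := by
  have h := integral_mul_trigSum_mul_conj (d := d) (fun _ => 1) continuous_const S S F F
  simp only [one_mul, integral_torusChar, sub_eq_zero, mul_ite, mul_one, mul_zero,
    Finset.sum_ite_eq, Complex.mul_conj'] at h
  have h2 : ((∫ θ, ‖trigSum S F θ‖ ^ 2 ∂torusMeasure d : ℝ) : ℂ)
      = ((∑ x ∈ S, ‖F x‖ ^ 2 : ℝ) : ℂ) := by
    rw [← integral_complex_ofReal]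
    push_cast
    rw [h]
    exact Finset.sum_congr rfl fun x hx => by simp [hx]
  exact_mod_cast h2

lemma trigSum_sub (S : Finset (Fin d → ℤ)) (F F' : (Fin d → ℤ) → ℂ)
    (θ : Fin d → AddCircle (1 : ℝ)) :
    trigSum S (F - F') θ = trigSum S F θ - trigSum S F' θ := by
  simp [trigSum, sub_mul]

lemma trigSum_add (S : Finset (Fin d → ℤ)) (F F' : (Fin d → ℤ) → ℂ)
    (θ : Fin d → AddCircle (1 : ℝ)) :
    trigSum S (F + F') θ = trigSum S F θ + trigSum S F' θ := by
  simp [trigSum, add_mul, Finset.sum_add_distrib]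

lemma integrable_resolventEnergy (a : Fin d → ℕ) (S : Finset (Fin d → ℤ))
    (F : (Fin d → ℤ) → ℂ) :
    Integrable (fun θ => boxResolvent a θ * ‖trigSum S F θ‖ ^ 2) (torusMeasure d) :=
  ((continuous_boxResolvent a).mul
    ((continuous_trigSum S F).norm.pow 2)).integrable_of_compactSpace

lemma resolventEnergy_nonneg (a : Fin d → ℕ) (S : Finset (Fin d → ℤ)) (F : (Fin d → ℤ) → ℂ) :
    0 ≤ resolventEnergy a S F :=
  integral_nonneg fun θ => mul_nonneg (boxResolvent_nonneg a θ) (by positivity)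

/-- Polarize, `|T|² - |T'|² = Re ((T - T') conj (T + T'))`, and bound the Fourier coefficients of
the resolvent by the geometric kernel. The bound is linear in the `ℓ¹` size of `F - F'`. -/
lemma resolventEnergy_sub_le (a : Fin d → ℕ) (S : Finset (Fin d → ℤ))
    (F F' : (Fin d → ℤ) → ℂ) :
    resolventEnergy a S F - resolventEnergy a S F'
      ≤ ∑ x ∈ S, ‖F x - F' x‖ * ∑ y ∈ S, geomKernel a (x - y) * (‖F y‖ + ‖F' y‖) := by
  have e1 : ((resolventEnergy a S F - resolventEnergy a S F' : ℝ) : ℂ).re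
      = (∫ θ, (boxResolvent a θ : ℂ) * (trigSum S (F - F') θ
          * (starRingEnd ℂ) (trigSum S (F + F') θ)) ∂torusMeasure d).re := by
    have hc : Continuous fun θ => (boxResolvent a θ : ℂ) * (trigSum S (F - F') θ
        * (starRingEnd ℂ) (trigSum S (F + F') θ)) :=
      (Complex.continuous_ofReal.comp (continuous_boxResolvent a)).mul
        ((continuous_trigSum _ _).mul (Complex.continuous_conj.comp (continuous_trigSum _ _)))
    rw [Complex.ofReal_re, resolventEnergy, resolventEnergy, ← integral_sub
      (integrable_resolventEnergy a S F) (integrable_resolventEnergy a S F')]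
    have := integral_re (𝕜 := ℂ) (μ := torusMeasure d) hc.integrable_of_compactSpace
    refine Eq.trans ?_ this
    congr 1
    ext θ
    simp only [RCLike.re_to_complex]
    rw [trigSum_sub, trigSum_add, Complex.re_ofReal_mul, ← mul_sub]
    congr 1
    rw [← Complex.normSq_eq_norm_sq, ← Complex.normSq_eq_norm_sq, Complex.normSq_apply,
      Complex.normSq_apply]
    simp
    ring
  rw [Complex.ofReal_re] at e1
  rw [e1, integral_mul_trigSum_mul_conj (fun θ => (boxResolvent a θ : ℂ))
    (Complex.continuous_ofReal.comp (continuous_boxResolvent a))]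
  refine (Complex.re_le_norm _).trans ((norm_sum_le _ _).trans (Finset.sum_le_sum fun x _ => ?_))
  rw [Finset.mul_sum]
  refine (norm_sum_le _ _).trans (Finset.sum_le_sum fun y _ => ?_)
  rw [norm_mul, norm_mul, RCLike.norm_conj, mul_assoc, mul_comm (geomKernel a (x - y))]
  refine mul_le_mul_of_nonneg_left ?_ (norm_nonneg _)
  exact mul_le_mul (norm_add_le _ _) (norm_integral_boxResolvent_mul_torusChar_le a _)
    (norm_nonneg _) (by positivity)

lemma card_latticeBox (l : Fin d → ℤ) (a : Fin d → ℕ) :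
    (latticeBox l (fun j => l j + 2 ^ a j)).card = ∏ j, 2 ^ a j := by
  simp [latticeBox, Fintype.card_piFinset, Int.toNat_pow_of_nonneg]

lemma boxSymbol_eq (l : Fin d → ℤ) (a : Fin d → ℕ) (θ : Fin d → AddCircle (1 : ℝ)) :
    boxSymbol l a θ = ((latticeBox l (fun j => l j + 2 ^ a j)).card : ℂ)⁻¹
      * ∑ m ∈ latticeBox l (fun j => l j + 2 ^ a j), torusChar m θ := by
  rw [card_latticeBox]
  simp only [boxSymbol, intervalSymbol, torusChar, latticeBox]
  rw [Finset.prod_mul_distrib, Finset.prod_univ_sum]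
  simp

lemma trigSum_shift {S W : Finset (Fin d → ℤ)} {F : (Fin d → ℤ) → ℂ} (hF : ∀ x ∉ S, F x = 0)
    (m : Fin d → ℤ) (hW : ∀ x ∈ S, x + m ∈ W) (θ : Fin d → AddCircle (1 : ℝ)) :
    ∑ n ∈ W, F (n - m) * torusChar n θ = torusChar m θ * trigSum S F θ := by
  have h : ∑ x ∈ S.map (addRightEmbedding m), F (x - m) * torusChar x θ
      = ∑ n ∈ W, F (n - m) * torusChar n θ := by
    refine Finset.sum_subset ?_ fun x _ hx => ?_
    · intro x hx
      obtain ⟨y, hy, rfl⟩ := Finset.mem_map.1 hx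
      exact hW y hy
    · rw [hF, zero_mul]
      intro hS
      exact hx (Finset.mem_map.2 ⟨_, hS, by simp⟩)
  rw [← h, Finset.sum_map, trigSum, Finset.mul_sum]
  refine Finset.sum_congr rfl fun x _ => ?_
  simp only [addRightEmbedding_apply, add_sub_cancel_right]
  rw [torusChar_add]
  ring

lemma trigSum_latticeAverage {S W : Finset (Fin d → ℤ)} {F : (Fin d → ℤ) → ℂ}
    (hF : ∀ x ∉ S, F x = 0) (l : Fin d → ℤ) (a : Fin d → ℕ)
    (hW : ∀ x ∈ S, ∀ m ∈ latticeBox l (fun j => l j + 2 ^ a j), x + m ∈ W)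
    (θ : Fin d → AddCircle (1 : ℝ)) :
    trigSum W (latticeAverage (latticeBox l (fun j => l j + 2 ^ a j)) F) θ
      = boxSymbol l a θ * trigSum S F θ := by
  rw [boxSymbol_eq, mul_assoc, Finset.sum_mul, trigSum]
  simp only [latticeAverage]
  simp_rw [mul_assoc, Finset.sum_mul]
  rw [← Finset.mul_sum, Finset.sum_comm]
  congr 1
  exact Finset.sum_congr rfl fun m hm => trigSum_shift hF m (fun x hx => hW x hx m hm) θ

/-- In a coordinate whose side does not grow, the resolvents agree, so the intervals must coincide
for the comparison to hold there. -/
lemma sq_norm_boxSymbol_sub_le {l l' : Fin d → ℤ} {a b : Fin d → ℕ}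
    (h0 : ∀ j, l j ≤ 0 ∧ 0 < l j + 2 ^ a j) (h0' : ∀ j, l' j ≤ 0 ∧ 0 < l' j + 2 ^ b j)
    (hab : ∀ j, a j < b j ∨ (a j = b j ∧ l j = l' j)) (θ : Fin d → AddCircle (1 : ℝ)) :
    ‖boxSymbol l a θ - boxSymbol l' b θ‖ ^ 2
      ≤ 292 * 34 ^ d * (boxResolvent a θ - boxResolvent b θ) := by
  have hd : ∀ j, ‖intervalSymbol (l j) (a j) (circleCoord (θ j))
      - intervalSymbol (l' j) (b j) (circleCoord (θ j))‖ ^ 2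
      ≤ 146 * (resolventSymbol (a j) (circleCoord (θ j))
        - resolventSymbol (b j) (circleCoord (θ j))) := by
    intro j
    rcases hab j with h | ⟨h, h'⟩
    · exact sq_norm_intervalSymbol_sub_le h (h0 j).1 (h0 j).2 (h0' j).1 (h0' j).2
        (norm_circleCoord _)
    · rw [h, h']; simp
  have := sq_norm_prod_sub_prod_le (Finset.univ : Finset (Fin d))
    (fun j => intervalSymbol (l j) (a j) (circleCoord (θ j)))
    (fun j => intervalSymbol (l' j) (b j) (circleCoord (θ j)))
    (fun j => resolventSymbol (a j) (circleCoord (θ j)))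
    (fun j => resolventSymbol (b j) (circleCoord (θ j)))
    (fun j _ => resolventSymbol_nonneg _ _)
    (fun j _ => by have := (sq_nonneg _).trans (hd j); linarith)
    (fun j _ => sq_norm_intervalSymbol_le _ _ (norm_circleCoord _))
    (fun j _ => sq_norm_intervalSymbol_le _ _ (norm_circleCoord _))
    (fun j _ => hd j)
  simpa [boxSymbol, boxResolvent] using this

/-- The mean square of a difference of two nested box averages is controlled by the drop of the
resolvent energy. -/
lemma sum_sq_norm_latticeAverage_sub_le {l l' : Fin d → ℤ} {a b : Fin d → ℕ}
    (h0 : ∀ j, l j ≤ 0 ∧ 0 < l j + 2 ^ a j) (h0' : ∀ j, l' j ≤ 0 ∧ 0 < l' j + 2 ^ b j)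
    (hab : ∀ j, a j < b j ∨ (a j = b j ∧ l j = l' j))
    {S : Finset (Fin d → ℤ)} {F : (Fin d → ℤ) → ℂ} (hF : ∀ x ∉ S, F x = 0)
    (Λ : Finset (Fin d → ℤ)) :
    ∑ n ∈ Λ, ‖latticeAverage (latticeBox l (fun j => l j + 2 ^ a j)) F n
        - latticeAverage (latticeBox l' (fun j => l' j + 2 ^ b j)) F n‖ ^ 2
      ≤ 292 * 34 ^ d * (resolventEnergy a S F - resolventEnergy b S F) := by
  classical
  set E := latticeBox l (fun j => l j + 2 ^ a j) with hE
  set E' := latticeBox l' (fun j => l' j + 2 ^ b j) with hE'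
  set W := Λ ∪ Finset.image₂ (· + ·) S (E ∪ E') with hW
  have w1 : ∀ x ∈ S, ∀ m ∈ E, x + m ∈ W := fun x hx m hm =>
    Finset.mem_union_right _ (Finset.mem_image₂_of_mem hx (Finset.mem_union_left _ hm))
  have w2 : ∀ x ∈ S, ∀ m ∈ E', x + m ∈ W := fun x hx m hm =>
    Finset.mem_union_right _ (Finset.mem_image₂_of_mem hx (Finset.mem_union_right _ hm))
  refine (Finset.sum_le_sum_of_subset_of_nonneg (Finset.subset_union_left (s₂ :=
    Finset.image₂ (· + ·) S (E ∪ E'))) (fun _ _ _ => by positivity)).trans ?_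
  have p := integral_sq_norm_trigSum W (latticeAverage E F - latticeAverage E' F)
  simp only [Pi.sub_apply] at p
  rw [← hW, ← p, resolventEnergy, resolventEnergy, ← integral_sub
    (integrable_resolventEnergy a S F) (integrable_resolventEnergy b S F), ← integral_const_mul]
  refine integral_mono
    ((continuous_trigSum _ _).norm.pow 2).integrable_of_compactSpace
    (((integrable_resolventEnergy a S F).sub (integrable_resolventEnergy b S F)).const_mul _)
    fun θ => ?_
  simp only
  rw [trigSum_sub, trigSum_latticeAverage hF l a w1, trigSum_latticeAverage hF l' b w2, ← sub_mul,
    norm_mul, mul_pow, ← sub_mul, ← mul_assoc]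
  exact mul_le_mul_of_nonneg_right (sq_norm_boxSymbol_sub_le h0 h0' hab θ) (by positivity)

end

/-! ### The geometric kernel against the dyadic grid -/

/-- Bernoulli's inequality: over one width `2 ^ a` the kernel loses at most half of its size. -/
lemma geomRatio_pow_ge (a : ℕ) : 1 / 2 ≤ geomRatio a ^ (2 ^ a) := by
  have h1 : (2 : ℝ) ^ (a + 1) = 2 ^ a * 2 := pow_succ _ _
  have h0 : (0 : ℝ) < 2 ^ a := by positivity
  have h2 : ((2 : ℝ) ^ (a + 1))⁻¹ ≤ 1 := by
    apply inv_le_one_of_one_le₀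
    exact one_le_pow₀ one_le_two
  have := one_add_mul_le_pow (a := -((2 : ℝ) ^ (a + 1))⁻¹) (by linarith) (2 ^ a)
  have e : 1 + ((2 ^ a : ℕ) : ℝ) * -((2 : ℝ) ^ (a + 1))⁻¹ = 1 / 2 := by
    rw [h1]; push_cast; field_simp; norm_num
  rw [e] at this
  simpa [geomRatio, sub_eq_add_neg] using this

lemma geomRatio_pow_le (a : ℕ) : geomRatio a ^ (2 ^ a) ≤ 2 / 3 := by
  have h0 : (0 : ℝ) < 2 ^ a := by positivity
  have h1 : geomRatio a ≤ Real.exp (-((2 : ℝ) ^ (a + 1))⁻¹) := by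
    have := Real.add_one_le_exp (-((2 : ℝ) ^ (a + 1))⁻¹)
    unfold geomRatio; linarith
  refine (pow_le_pow_left₀ (geomRatio_pos a).le h1 _).trans ?_
  rw [← Real.exp_nat_mul]
  have e : ((2 ^ a : ℕ) : ℝ) * -((2 : ℝ) ^ (a + 1))⁻¹ = -(1 / 2) := by
    rw [pow_succ]; push_cast; field_simp
  rw [e, Real.exp_neg]
  have := Real.add_one_le_exp (1 / 2 : ℝ)
  rw [inv_le_comm₀ (Real.exp_pos _) (by norm_num)]
  linarith

/-- Points whose cells differ by `k` are at distance at least `(k - 1) 2 ^ a`. Each full width gives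
a factor at most `2 / 3`, and the missing one costs at most 2. -/
lemma geomRatio_pow_natAbs_sub_le (a : ℕ) (n y : ℤ) :
    geomRatio a ^ (n - y).natAbs
      ≤ 2 * (2 / 3 : ℝ) ^ (y / 2 ^ a - n / 2 ^ a).natAbs := by
  have p0 := geomRatio_pos a
  have p1 := (geomRatio_lt_one a).le
  have hM : (0 : ℤ) < 2 ^ a := by positivity
  have h : 2 ^ a * (y / 2 ^ a - n / 2 ^ a).natAbs ≤ (n - y).natAbs + 2 ^ a := by
    have h1 := Int.emod_add_mul_ediv y (2 ^ a)
    have h2 := Int.emod_add_mul_ediv n (2 ^ a)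
    have h3 := Int.emod_nonneg y hM.ne'
    have h4 := Int.emod_nonneg n hM.ne'
    have h5 := Int.emod_lt_of_pos y hM
    have h6 := Int.emod_lt_of_pos n hM
    zify
    rw [← abs_of_pos hM, ← abs_mul, abs_of_pos hM, abs_le]
    have := le_abs_self (n - y)
    have := neg_abs_le (n - y)
    constructor <;> linarith
  have h1 : geomRatio a ^ ((n - y).natAbs + 2 ^ a)
      ≤ (2 / 3 : ℝ) ^ (y / 2 ^ a - n / 2 ^ a).natAbs := by
    refine (pow_le_pow_of_le_one p0.le p1 h).trans ?_
    rw [pow_mul]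
    exact pow_le_pow_left₀ (by positivity) (geomRatio_pow_le a) _
  rw [pow_add] at h1
  have h2 := geomRatio_pow_ge a
  have h3 : 0 ≤ geomRatio a ^ (n - y).natAbs := by positivity
  nlinarith

lemma hasSum_two_thirds_pow_natAbs : HasSum (fun q : ℤ => (2 / 3 : ℝ) ^ q.natAbs) 5 := by
  have h := hasSum_geometric_of_lt_one (r := (2 / 3 : ℝ)) (by norm_num) (by norm_num)
  have e : (1 - 2 / 3 : ℝ)⁻¹ = 3 := by norm_num
  rw [e] at h
  have e2 : (5 : ℝ) = 3 + 2 / 3 * 3 := by norm_num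
  rw [e2]
  refine HasSum.of_nat_of_neg_add_one (f := fun q : ℤ => (2 / 3 : ℝ) ^ q.natAbs) h ?_
  refine (h.mul_left (2 / 3)).congr_fun fun n => ?_
  rw [← pow_succ', Int.natAbs_neg]
  rfl

lemma sum_two_thirds_pow_natAbs_sub_le (Q : Finset ℤ) (c : ℤ) :
    ∑ q ∈ Q, (2 / 3 : ℝ) ^ (q - c).natAbs ≤ 5 := by
  rw [← Finset.sum_image (f := fun q : ℤ => (2 / 3 : ℝ) ^ q.natAbs) (g := fun q => q - c)
    fun x _ y _ h => sub_left_injective h]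
  exact sum_le_hasSum _ (fun _ _ => by positivity) hasSum_two_thirds_pow_natAbs

/-- The index of the grid box with sides `2 ^ a j` which contains `x`. -/
def gridIndex {d : ℕ} (a : Fin d → ℕ) (x : Fin d → ℤ) : Fin d → ℤ := fun j => x j / 2 ^ a j

section
variable {d : ℕ}

lemma geomKernel_sub_le (a : Fin d → ℕ) (n y : Fin d → ℤ) :
    geomKernel a (n - y) ≤ (∏ j, (2 : ℝ) ^ a j)⁻¹
      * ∏ j, 2 * (2 / 3 : ℝ) ^ (gridIndex a y j - gridIndex a n j).natAbs := by
  rw [geomKernel, Finset.prod_mul_distrib, ← Finset.prod_inv_distrib]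
  refine mul_le_mul_of_nonneg_left ?_ (by positivity)
  exact Finset.prod_le_prod (fun _ _ => pow_nonneg (geomRatio_pos _).le _)
    fun j _ => geomRatio_pow_natAbs_sub_le _ _ _

lemma sum_prod_two_thirds_le (Q : Finset (Fin d → ℤ)) (c : Fin d → ℤ) :
    ∑ q ∈ Q, ∏ j, 2 * (2 / 3 : ℝ) ^ (q j - c j).natAbs ≤ 10 ^ d := by
  classical
  have hQ : Q ⊆ Fintype.piFinset fun j => Q.image fun q => q j := fun q hq =>
    Fintype.mem_piFinset.2 fun j => Finset.mem_image_of_mem _ hq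
  refine (Finset.sum_le_sum_of_subset_of_nonneg hQ fun _ _ _ => by positivity).trans ?_
  rw [← Finset.prod_univ_sum (fun j => Q.image fun q => q j)
    (fun j q => 2 * (2 / 3 : ℝ) ^ (q - c j).natAbs)]
  refine (Finset.prod_le_prod (fun _ _ => Finset.sum_nonneg fun _ _ => by positivity)
    (fun j _ => ?_)).trans (b := ∏ j : Fin d, (10 : ℝ)) (by simp)
  rw [← Finset.mul_sum]
  have := sum_two_thirds_pow_natAbs_sub_le (Q.image fun q => q j) (c j)
  linarith

/-- If the means of `‖F‖` over the grid boxes are at most `t`, then so are, up to a constant, its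
averages against the geometric kernel of the same widths. -/
lemma sum_geomKernel_mul_le (a : Fin d → ℕ) (S : Finset (Fin d → ℤ)) (F : (Fin d → ℤ) → ℂ)
    {t : ℝ} (ht : 0 ≤ t)
    (hF : ∀ q, ∑ y ∈ S with gridIndex a y = q, ‖F y‖ ≤ t * ∏ j, (2 : ℝ) ^ a j)
    (n : Fin d → ℤ) :
    ∑ y ∈ S, geomKernel a (n - y) * ‖F y‖ ≤ 10 ^ d * t := by
  classical
  rw [← Finset.sum_fiberwise_of_maps_to (g := gridIndex a) (t := S.image (gridIndex a))
    (fun y hy => Finset.mem_image_of_mem _ hy)]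
  calc ∑ q ∈ S.image (gridIndex a), ∑ y ∈ S with gridIndex a y = q, geomKernel a (n - y) * ‖F y‖
      ≤ ∑ q ∈ S.image (gridIndex a),
          (∏ j, 2 * (2 / 3 : ℝ) ^ (q j - gridIndex a n j).natAbs) * t := by
        refine Finset.sum_le_sum fun q _ => ?_
        have h1 : ∑ y ∈ S with gridIndex a y = q, geomKernel a (n - y) * ‖F y‖
            ≤ ∑ y ∈ S with gridIndex a y = q, (∏ j, (2 : ℝ) ^ a j)⁻¹
              * (∏ j, 2 * (2 / 3 : ℝ) ^ (q j - gridIndex a n j).natAbs) * ‖F y‖ := by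
          refine Finset.sum_le_sum fun y hy => ?_
          obtain ⟨_, rfl⟩ := Finset.mem_filter.1 hy
          exact mul_le_mul_of_nonneg_right (geomKernel_sub_le a n y) (norm_nonneg _)
        refine h1.trans ?_
        rw [← Finset.mul_sum]
        refine (mul_le_mul_of_nonneg_left (hF q) (by positivity)).trans (le_of_eq ?_)
        have : (∏ j, (2 : ℝ) ^ a j) ≠ 0 := by positivity
        field_simp
    _ = (∑ q ∈ S.image (gridIndex a),
          ∏ j, 2 * (2 / 3 : ℝ) ^ (q j - gridIndex a n j).natAbs) * t := by rw [Finset.sum_mul]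
    _ ≤ 10 ^ d * t := mul_le_mul_of_nonneg_right (sum_prod_two_thirds_le _ _) ht

lemma mem_latticeBox {l u x : Fin d → ℤ} : x ∈ latticeBox l u ↔ ∀ j, l j ≤ x j ∧ x j < u j := by
  simp [latticeBox]

/-- Within one width the kernel is comparable to its maximum, so it dominates the kernel of any box
of these sides that contains the origin. -/
lemma inv_prod_le_geomKernel (a : Fin d → ℕ) {m : Fin d → ℤ} (hm : ∀ j, |m j| < 2 ^ a j) :
    (∏ j, (2 : ℝ) ^ a j)⁻¹ ≤ 2 ^ d * geomKernel a m := by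
  have : (2 : ℝ) ^ d = ∏ _j : Fin d, 2 := by simp
  rw [this, geomKernel, ← Finset.prod_mul_distrib, ← Finset.prod_inv_distrib]
  refine Finset.prod_le_prod (fun _ _ => by positivity) fun j _ => ?_
  have h : (m j).natAbs ≤ 2 ^ a j := by
    have := hm j; zify; exact this.le
  have h1 := pow_le_pow_of_le_one (geomRatio_pos (a j)).le (geomRatio_lt_one (a j)).le h
  have h2 := geomRatio_pow_ge (a j)
  have h3 : (0 : ℝ) < ((2 : ℝ) ^ a j)⁻¹ := by positivity
  nlinarith

lemma norm_latticeAverage_le_sum (E : Finset (Fin d → ℤ)) (F : (Fin d → ℤ) → ℂ)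
    (n : Fin d → ℤ) :
    ‖latticeAverage E F n‖ ≤ (E.card : ℝ)⁻¹ * ∑ m ∈ E, ‖F (n - m)‖ := by
  rw [latticeAverage, norm_mul, norm_inv, Complex.norm_natCast]
  exact mul_le_mul_of_nonneg_left (norm_sum_le _ _) (by positivity)

lemma norm_latticeAverage_le {l : Fin d → ℤ} {a : Fin d → ℕ}
    (h0 : ∀ j, l j ≤ 0 ∧ 0 < l j + 2 ^ a j) {S : Finset (Fin d → ℤ)} {F : (Fin d → ℤ) → ℂ}
    (hF : ∀ x ∉ S, F x = 0) (n : Fin d → ℤ) :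
    ‖latticeAverage (latticeBox l (fun j => l j + 2 ^ a j)) F n‖
      ≤ 2 ^ d * ∑ y ∈ S, geomKernel a (n - y) * ‖F y‖ := by
  classical
  refine (norm_latticeAverage_le_sum _ _ _).trans ?_
  rw [card_latticeBox, Finset.mul_sum, Finset.mul_sum]
  push_cast
  set E := latticeBox l (fun j => l j + 2 ^ a j)
  calc ∑ m ∈ E, (∏ j, (2 : ℝ) ^ a j)⁻¹ * ‖F (n - m)‖
      ≤ ∑ m ∈ E, 2 ^ d * (geomKernel a (n - (n - m)) * ‖F (n - m)‖) := by
        refine Finset.sum_le_sum fun m hm => ?_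
        rw [sub_sub_cancel, ← mul_assoc]
        refine mul_le_mul_of_nonneg_right (inv_prod_le_geomKernel a fun j => ?_) (norm_nonneg _)
        have := mem_latticeBox.1 hm j
        have := h0 j
        rw [abs_lt]; constructor <;> linarith
    _ = ∑ y ∈ E.image (fun m => n - m), 2 ^ d * (geomKernel a (n - y) * ‖F y‖) := by
        rw [Finset.sum_image fun x _ y _ h => sub_right_injective h]
    _ = ∑ y ∈ (E.image fun m => n - m) with y ∈ S, 2 ^ d * (geomKernel a (n - y) * ‖F y‖) := by
        refine (Finset.sum_filter_of_ne fun y _ hy => ?_).symm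
        by_contra hS
        exact hy (by simp [hF y hS])
    _ ≤ _ := by
        refine Finset.sum_le_sum_of_subset_of_nonneg (fun y hy => (Finset.mem_filter.1 hy).2)
          fun _ _ _ => ?_
        exact mul_nonneg (by positivity) (mul_nonneg (geomKernel_nonneg a _) (norm_nonneg _))

lemma sum_norm_latticeAverage_le (E : Finset (Fin d → ℤ)) {S : Finset (Fin d → ℤ)}
    {F : (Fin d → ℤ) → ℂ} (hF : ∀ x ∉ S, F x = 0) (Λ : Finset (Fin d → ℤ)) :
    ∑ n ∈ Λ, ‖latticeAverage E F n‖ ≤ ∑ x ∈ S, ‖F x‖ := by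
  classical
  refine (Finset.sum_le_sum fun n _ => norm_latticeAverage_le_sum E F n).trans ?_
  rw [← Finset.mul_sum, Finset.sum_comm]
  have h : ∀ m ∈ E, ∑ n ∈ Λ, ‖F (n - m)‖ ≤ ∑ x ∈ S, ‖F x‖ := by
    intro m _
    rw [← Finset.sum_image (f := fun y => ‖F y‖) (g := fun n => n - m)
      fun x _ y _ h => sub_left_injective h]
    rw [← Finset.sum_filter_of_ne (p := (· ∈ S))]
    · exact Finset.sum_le_sum_of_subset_of_nonneg (fun y hy => (Finset.mem_filter.1 hy).2)
        fun _ _ _ => norm_nonneg _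
    · intro y _ hy
      by_contra hS
      exact hy (by simp [hF y hS])
  have h2 := Finset.sum_le_sum h
  rw [Finset.sum_const, nsmul_eq_mul] at h2
  rcases E.eq_empty_or_nonempty with rfl | hE
  · simpa using Finset.sum_nonneg fun _ _ => norm_nonneg _
  · have : (0 : ℝ) < E.card := by exact_mod_cast hE.card_pos
    rw [inv_mul_le_iff₀ this]
    exact h2

end

/-! ### The stopping procedure and its exceptional set -/

/-- The mean of `‖f‖`, for `f` supported on `S`, over the grid box with sides `2 ^ a j` which
contains `x`. -/
noncomputable def gridMean {d : ℕ} (a : Fin d → ℕ) (S : Finset (Fin d → ℤ))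
    (f : (Fin d → ℤ) → ℂ) (x : Fin d → ℤ) : ℝ :=
  (∏ j, (2 : ℝ) ^ a j)⁻¹ * ∑ y ∈ S with gridIndex a y = gridIndex a x, ‖f y‖

open Classical in
/-- The part of `f` on which all grid means at the levels `i, …, N` are at most `t`. -/
noncomputable def stoppedFun {d : ℕ} (a : ℕ → Fin d → ℕ) (S : Finset (Fin d → ℤ))
    (f : (Fin d → ℤ) → ℂ) (t : ℝ) (N i : ℕ) (x : Fin d → ℤ) : ℂ :=
  if ∀ k, i ≤ k → k ≤ N → gridMean (a k) S f x ≤ t then f x else 0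

section
variable {d : ℕ}

lemma gridIndex_eq_of_le {a b : Fin d → ℕ} (h : a ≤ b) {x y : Fin d → ℤ}
    (hxy : gridIndex a x = gridIndex a y) : gridIndex b x = gridIndex b y := by
  funext j
  have hj := congrFun hxy j
  simp only [gridIndex] at hj ⊢
  rw [← Nat.add_sub_of_le (h j), pow_add, ← Int.ediv_ediv_of_nonneg (by positivity),
    ← Int.ediv_ediv_of_nonneg (by positivity), hj]

lemma gridMean_congr {a b : Fin d → ℕ} (h : a ≤ b) (S : Finset (Fin d → ℤ))
    (f : (Fin d → ℤ) → ℂ) {x y : Fin d → ℤ} (hxy : gridIndex a x = gridIndex a y) :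
    gridMean b S f x = gridMean b S f y := by
  rw [gridMean, gridMean, gridIndex_eq_of_le h hxy]

lemma norm_stoppedFun_le (a : ℕ → Fin d → ℕ) (S : Finset (Fin d → ℤ)) (f : (Fin d → ℤ) → ℂ)
    (t : ℝ) (N i : ℕ) (x : Fin d → ℤ) : ‖stoppedFun a S f t N i x‖ ≤ ‖f x‖ := by
  unfold stoppedFun
  split_ifs <;> simp

lemma stoppedFun_eq_zero {a : ℕ → Fin d → ℕ} {S : Finset (Fin d → ℤ)} {f : (Fin d → ℤ) → ℂ}
    (hf : ∀ x ∉ S, f x = 0) (t : ℝ) (N i : ℕ) : ∀ x ∉ S, stoppedFun a S f t N i x = 0 := by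
  intro x hx
  unfold stoppedFun
  rw [hf x hx, ite_self]

/-- Either both functions have the same value, or the one at level `i` vanishes. Thus the norms of
the increments telescope. -/
lemma norm_stoppedFun_succ_sub (a : ℕ → Fin d → ℕ) (S : Finset (Fin d → ℤ))
    (f : (Fin d → ℤ) → ℂ) (t : ℝ) (N i : ℕ) (x : Fin d → ℤ) :
    ‖stoppedFun a S f t N (i + 1) x - stoppedFun a S f t N i x‖
      = ‖stoppedFun a S f t N (i + 1) x‖ - ‖stoppedFun a S f t N i x‖ := by
  unfold stoppedFun
  by_cases h : ∀ k, i ≤ k → k ≤ N → gridMean (a k) S f x ≤ t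
  · rw [if_pos h, if_pos fun k hk => h k (by omega)]; simp
  · rw [if_neg h]; simp

/-- One surviving point in a grid box already forces the mean of the whole `|f|` over that box to be
at most `t`; a box without one contributes nothing. -/
lemma sum_norm_stoppedFun_le (a : ℕ → Fin d → ℕ) (S : Finset (Fin d → ℤ))
    (f : (Fin d → ℤ) → ℂ) {t : ℝ} (ht : 0 ≤ t) {N i : ℕ} (hi : i ≤ N) (q : Fin d → ℤ) :
    ∑ y ∈ S with gridIndex (a i) y = q, ‖stoppedFun a S f t N i y‖
      ≤ t * ∏ j, (2 : ℝ) ^ a i j := by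
  by_cases h : ∃ z ∈ S, gridIndex (a i) z = q ∧ stoppedFun a S f t N i z ≠ 0
  · obtain ⟨z, _, rfl, hz⟩ := h
    have hg : ∀ k, i ≤ k → k ≤ N → gridMean (a k) S f z ≤ t := by
      by_contra hg
      exact hz (if_neg hg)
    have := hg i le_rfl hi
    rw [gridMean, inv_mul_le_iff₀ (by positivity), mul_comm] at this
    exact (Finset.sum_le_sum fun y _ => norm_stoppedFun_le a S f t N i y).trans this
  · push Not at h
    rw [Finset.sum_eq_zero fun y hy => ?_]
    · positivity
    · obtain ⟨h1, h2⟩ := Finset.mem_filter.1 hy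
      rw [h y h1 h2, norm_zero]

lemma mem_gridBox {a : Fin d → ℕ} {q x : Fin d → ℤ} :
    x ∈ latticeBox (fun j => q j * 2 ^ a j) (fun j => q j * 2 ^ a j + 2 ^ a j)
      ↔ gridIndex a x = q := by
  rw [mem_latticeBox, funext_iff]
  refine forall_congr' fun j => ?_
  simp only [gridIndex]
  have hM : (0 : ℤ) < 2 ^ a j := by positivity
  rw [Int.ediv_eq_iff_of_pos hM]

/-- The points whose grid mean at level `k` exceeds `t` while those at the levels up to `N` above
`k` do not. -/
def IsStoppedAt (a : ℕ → Fin d → ℕ) (S : Finset (Fin d → ℤ)) (f : (Fin d → ℤ) → ℂ) (t : ℝ)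
    (N k : ℕ) (x : Fin d → ℤ) : Prop :=
  t < gridMean (a k) S f x ∧ ∀ k', k < k' → k' ≤ N → gridMean (a k') S f x ≤ t

lemma IsStoppedAt.congr {a : ℕ → Fin d → ℕ} (ha : Monotone a) {S : Finset (Fin d → ℤ)}
    {f : (Fin d → ℤ) → ℂ} {t : ℝ} {N k : ℕ} {x y : Fin d → ℤ}
    (hx : IsStoppedAt a S f t N k x) (hxy : gridIndex (a k) x = gridIndex (a k) y) :
    IsStoppedAt a S f t N k y := by
  refine ⟨gridMean_congr le_rfl S f hxy ▸ hx.1, fun k' h h' => ?_⟩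
  rw [← gridMean_congr (ha h.le) S f hxy]
  exact hx.2 k' h h'

lemma finite_setOf_isStoppedAt (a : ℕ → Fin d → ℕ) (S : Finset (Fin d → ℤ))
    (f : (Fin d → ℤ) → ℂ) {t : ℝ} (ht : 0 ≤ t) (N k : ℕ) :
    {x | IsStoppedAt a S f t N k x}.Finite := by
  classical
  refine (S.biUnion fun y => latticeBox (fun j => gridIndex (a k) y j * 2 ^ a k j)
    (fun j => gridIndex (a k) y j * 2 ^ a k j + 2 ^ a k j)).finite_toSet.subset fun x hx => ?_
  have h : 0 < gridMean (a k) S f x := ht.trans_lt hx.1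
  obtain ⟨y, hy⟩ : (S.filter fun y => gridIndex (a k) y = gridIndex (a k) x).Nonempty := by
    rw [Finset.nonempty_iff_ne_empty]
    intro h0
    rw [gridMean, h0] at h
    simp at h
  obtain ⟨h1, h2⟩ := Finset.mem_filter.1 hy
  simp only [Finset.coe_biUnion, Set.mem_iUnion]
  exact ⟨y, h1, mem_gridBox.2 h2.symm⟩

-- The set stopped at level `k` is a union of grid boxes of that level. After exchanging the sums,
-- each stopped `y` has weight at most 1 and every other `y` has weight 0.
open Classical in
lemma mul_card_isStoppedAt_le {a : ℕ → Fin d → ℕ} (ha : Monotone a) (S : Finset (Fin d → ℤ))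
    (f : (Fin d → ℤ) → ℂ) {t : ℝ} (N k : ℕ) (K : Finset (Fin d → ℤ))
    (hK : ∀ x ∈ K, IsStoppedAt a S f t N k x) :
    t * K.card ≤ ∑ y ∈ S with IsStoppedAt a S f t N k y, ‖f y‖ := by
  calc t * K.card = ∑ x ∈ K, t := by simp [mul_comm]
    _ ≤ ∑ x ∈ K, gridMean (a k) S f x := Finset.sum_le_sum fun x hx => (hK x hx).1.le
    _ = ∑ y ∈ S, ∑ x ∈ K, if gridIndex (a k) y = gridIndex (a k) x
          then (∏ j, (2 : ℝ) ^ a k j)⁻¹ * ‖f y‖ else 0 := by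
        rw [Finset.sum_comm]
        refine Finset.sum_congr rfl fun x _ => ?_
        rw [gridMean, Finset.mul_sum, Finset.sum_filter]
    _ ≤ ∑ y ∈ S, if IsStoppedAt a S f t N k y then ‖f y‖ else 0 := by
        refine Finset.sum_le_sum fun y _ => ?_
        rw [← Finset.sum_filter, Finset.sum_const, nsmul_eq_mul]
        have hP : (0 : ℝ) < ∏ j, (2 : ℝ) ^ a k j := by positivity
        split_ifs with h
        · have hc : ((K.filter fun x => gridIndex (a k) y = gridIndex (a k) x).card : ℝ)
              ≤ ∏ j, (2 : ℝ) ^ a k j := by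
            have := Finset.card_le_card (s := K.filter fun x => gridIndex (a k) y = gridIndex (a k) x)
              (t := latticeBox (fun j => gridIndex (a k) y j * 2 ^ a k j)
                (fun j => gridIndex (a k) y j * 2 ^ a k j + 2 ^ a k j))
              fun x hx => mem_gridBox.2 (Finset.mem_filter.1 hx).2.symm
            rw [card_latticeBox] at this
            exact_mod_cast this
          rw [← mul_assoc, ← div_eq_mul_inv]
          refine mul_le_of_le_one_left (norm_nonneg _) ?_
          rwa [div_le_one hP]
        · rw [Finset.filter_eq_empty_iff.2 fun x hx hxy => h ((hK x hx).congr ha hxy.symm)]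
          simp
    _ = _ := by rw [Finset.sum_filter]

/-- A shift smaller than the sides leads to the same or an adjacent cell in each coordinate. -/
lemma exists_gridIndex_sub_eq {a : Fin d → ℕ} {m n : Fin d → ℤ} (hm : ∀ j, |m j| < 2 ^ a j) :
    ∃ e ∈ Fintype.piFinset fun _ : Fin d => ({-1, 0, 1} : Finset ℤ),
      gridIndex a (n - m) = gridIndex a (n - fun j => e j * 2 ^ a j) := by
  refine ⟨fun j => n j / 2 ^ a j - (n j - m j) / 2 ^ a j, ?_, ?_⟩
  · rw [Fintype.mem_piFinset]
    intro j
    have hM : (0 : ℤ) < 2 ^ a j := by positivity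
    have hs : ∀ x : ℤ, (x + 2 ^ a j) / 2 ^ a j = x / 2 ^ a j + 1 := fun x => by
      rw [Int.add_ediv_of_dvd_right (dvd_refl _), Int.ediv_self hM.ne']
    have h1 : n j / 2 ^ a j ≤ (n j - m j) / 2 ^ a j + 1 := by
      rw [← hs]
      exact Int.ediv_le_ediv hM (by have := (abs_lt.1 (hm j)).2; linarith)
    have h2 : (n j - m j) / 2 ^ a j ≤ n j / 2 ^ a j + 1 := by
      rw [← hs]
      exact Int.ediv_le_ediv hM (by have := (abs_lt.1 (hm j)).1; linarith)
    simp only [Finset.mem_insert, Finset.mem_singleton]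
    omega
  · funext j
    have hM : (2 : ℤ) ^ a j ≠ 0 := by positivity
    simp only [gridIndex, Pi.sub_apply]
    rw [sub_eq_add_neg (n j) (_ * _), ← neg_mul, Int.add_mul_ediv_right _ _ hM]
    ring

open Classical in
/-- The exceptional set of the stopping procedure is small. -/
lemma mul_card_exceptional_le {l : ℕ → Fin d → ℤ} {a : ℕ → Fin d → ℕ} (ha : Monotone a)
    (h0 : ∀ i j, l i j ≤ 0 ∧ 0 < l i j + 2 ^ a i j) (S : Finset (Fin d → ℤ))
    (f : (Fin d → ℤ) → ℂ) {t : ℝ} (ht : 0 ≤ t) (N : ℕ) (Λ : Finset (Fin d → ℤ))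
    (hΛ : ∀ n ∈ Λ, ∃ i ≤ N, ∃ m ∈ latticeBox (l i) (fun j => l i j + 2 ^ a i j),
      ∃ k, i ≤ k ∧ k ≤ N ∧ t < gridMean (a k) S f (n - m)) :
    t * Λ.card ≤ 3 ^ d * ∑ x ∈ S, ‖f x‖ := by
  set K : ℕ → Finset (Fin d → ℤ) := fun k => (finite_setOf_isStoppedAt a S f ht N k).toFinset
    with hK
  have mK : ∀ k x, x ∈ K k ↔ IsStoppedAt a S f t N k x := fun k x => by simp [hK]
  set D := Fintype.piFinset fun _ : Fin d => ({-1, 0, 1} : Finset ℤ) with hD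
  have cD : D.card = 3 ^ d := by simp [hD, Fintype.card_piFinset]
  have hsub : Λ ⊆ (Finset.range (N + 1)).biUnion fun k => D.biUnion fun e =>
      (K k).image fun x => x + fun j => e j * 2 ^ a k j := by
    intro n hn
    obtain ⟨i, _, m, hm, k, hik, hkN, hk⟩ := hΛ n hn
    have hne : ((Finset.range (N + 1)).filter fun k =>
        i ≤ k ∧ t < gridMean (a k) S f (n - m)).Nonempty :=
      ⟨k, by simp only [Finset.mem_filter, Finset.mem_range]; exact ⟨by omega, hik, hk⟩⟩
    -- At the last level `p` whose mean exceeds `t`, the point `n - m` is stopped. As `p ≥ i`, the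
    -- shift `m` is smaller than the sides at level `p`, so `n` lies in one of `3 ^ d` translates of
    -- the stopped set.
    obtain ⟨p, hp, hmax⟩ := Finset.exists_max_image _ id hne
    simp only [Finset.mem_filter, Finset.mem_range, id] at hp hmax
    have hx : IsStoppedAt a S f t N p (n - m) := by
      refine ⟨hp.2.2, fun k' h1 h2 => ?_⟩
      by_contra h3
      have := hmax k' ⟨by omega, by omega, not_le.1 h3⟩
      omega
    have hm' : ∀ j, |m j| < 2 ^ a p j := by
      intro j
      have h1 := mem_latticeBox.1 hm j
      have h2 := h0 i j
      have h3 : (2 : ℤ) ^ a i j ≤ 2 ^ a p j :=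
        pow_le_pow_right₀ (by norm_num) (ha hp.2.1 j)
      rw [abs_lt]; constructor <;> linarith
    obtain ⟨e, he, heq⟩ := exists_gridIndex_sub_eq (n := n) hm'
    simp only [Finset.mem_biUnion, Finset.mem_range, Finset.mem_image]
    exact ⟨p, hp.1, e, he, _, (mK _ _).2 (hx.congr ha heq), sub_add_cancel _ _⟩
  have hcard : Λ.card ≤ ∑ k ∈ Finset.range (N + 1), 3 ^ d * (K k).card := by
    refine (Finset.card_le_card hsub).trans (Finset.card_biUnion_le.trans
      (Finset.sum_le_sum fun k _ => Finset.card_biUnion_le.trans ?_))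
    rw [← cD, ← smul_eq_mul, ← Finset.sum_const]
    exact Finset.sum_le_sum fun e _ => Finset.card_image_le
  have hcard' : (Λ.card : ℝ) ≤ ∑ k ∈ Finset.range (N + 1), 3 ^ d * ((K k).card : ℝ) := by
    exact_mod_cast hcard
  refine (mul_le_mul_of_nonneg_left hcard' ht).trans ?_
  rw [← Finset.mul_sum, mul_left_comm]
  refine mul_le_mul_of_nonneg_left ?_ (by positivity)
  rw [Finset.mul_sum]
  refine (Finset.sum_le_sum fun k _ =>
    mul_card_isStoppedAt_le ha S f N k (K k) fun x hx => (mK k x).1 hx).trans ?_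
  simp_rw [Finset.sum_filter]
  rw [Finset.sum_comm]
  refine Finset.sum_le_sum fun y _ => ?_
  -- A point is stopped at no more than one level, so its mass is counted at most once.
  by_cases h : ∃ k ∈ Finset.range (N + 1), IsStoppedAt a S f t N k y
  · obtain ⟨k, hk, hks⟩ := h
    rw [Finset.sum_eq_single k, if_pos hks]
    · intro k' hk' hne
      rw [if_neg]
      intro hks'
      simp only [Finset.mem_range] at hk hk'
      rcases lt_or_gt_of_ne hne with h | h
      · exact absurd hks.1 (not_lt.2 (hks'.2 k h (by omega)))
      · exact absurd hks'.1 (not_lt.2 (hks.2 k' h (by omega)))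
    · intro h; exact absurd hk h
  · push Not at h
    rw [Finset.sum_eq_zero fun k hk => if_neg (h k hk)]
    exact norm_nonneg _

end

/-! ### The weak type inequality for boxes containing the origin -/

section
variable {d : ℕ}

lemma latticeAverage_sub (E : Finset (Fin d → ℤ)) (F F' : (Fin d → ℤ) → ℂ) (n : Fin d → ℤ) :
    latticeAverage E (F - F') n = latticeAverage E F n - latticeAverage E F' n := by
  simp [latticeAverage, Finset.sum_sub_distrib, mul_sub]

lemma latticeAverage_congr {E : Finset (Fin d → ℤ)} {F F' : (Fin d → ℤ) → ℂ} {n : Fin d → ℤ}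
    (h : ∀ m ∈ E, F (n - m) = F' (n - m)) : latticeAverage E F n = latticeAverage E F' n := by
  rw [latticeAverage, latticeAverage, Finset.sum_congr rfl h]

lemma sum_geomKernel_mul_stoppedFun_le (a : ℕ → Fin d → ℕ) (S : Finset (Fin d → ℤ))
    (f : (Fin d → ℤ) → ℂ) {t : ℝ} (ht : 0 ≤ t) {N i : ℕ} (hi : i ≤ N) (n : Fin d → ℤ) :
    ∑ y ∈ S, geomKernel (a i) (n - y) * ‖stoppedFun a S f t N i y‖ ≤ 10 ^ d * t :=
  sum_geomKernel_mul_le (a i) S _ ht (sum_norm_stoppedFun_le a S f ht hi) n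

lemma norm_stoppedFun_le_succ (a : ℕ → Fin d → ℕ) (S : Finset (Fin d → ℤ))
    (f : (Fin d → ℤ) → ℂ) (t : ℝ) (N i : ℕ) (x : Fin d → ℤ) :
    ‖stoppedFun a S f t N i x‖ ≤ ‖stoppedFun a S f t N (i + 1) x‖ := by
  have := norm_stoppedFun_succ_sub a S f t N i x
  have := norm_nonneg (stoppedFun a S f t N (i + 1) x - stoppedFun a S f t N i x)
  linarith

lemma sum_norm_stoppedFun_succ_sub_le (a : ℕ → Fin d → ℕ) (S : Finset (Fin d → ℤ))
    (f : (Fin d → ℤ) → ℂ) (t : ℝ) (N : ℕ) :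
    ∑ x ∈ S, ‖stoppedFun a S f t N 0 x‖ + ∑ i ∈ Finset.range N, ∑ x ∈ S,
      ‖stoppedFun a S f t N (i + 1) x - stoppedFun a S f t N i x‖ ≤ ∑ x ∈ S, ‖f x‖ := by
  simp_rw [norm_stoppedFun_succ_sub]
  rw [Finset.sum_comm, ← Finset.sum_add_distrib]
  refine Finset.sum_le_sum fun x _ => ?_
  rw [Finset.sum_range_sub (fun i => ‖stoppedFun a S f t N i x‖)]
  linarith [norm_stoppedFun_le a S f t N N x]

/-- Summation by parts: the final energy has a favourable sign, and the initial energy and the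
changes of `F` at fixed level are each `O(t)` times an `ℓ¹` norm, with total at most `‖f‖₁`. -/
lemma sum_resolventEnergy_drop_le (a : ℕ → Fin d → ℕ) (S : Finset (Fin d → ℤ))
    (f : (Fin d → ℤ) → ℂ) {t : ℝ} (ht : 0 ≤ t) (N : ℕ) :
    ∑ i ∈ Finset.range N, (resolventEnergy (a i) S (stoppedFun a S f t N i)
        - resolventEnergy (a (i + 1)) S (stoppedFun a S f t N i))
      ≤ 2 * 10 ^ d * t * ∑ x ∈ S, ‖f x‖ := by
  set F := stoppedFun a S f t N with hF
  have h0 : resolventEnergy (a 0) S (F 0) ≤ 2 * 10 ^ d * t * ∑ x ∈ S, ‖F 0 x‖ := by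
    have h := resolventEnergy_sub_le (a 0) S (F 0) 0
    have hz : resolventEnergy (a 0) S 0 = 0 := by simp [resolventEnergy, trigSum]
    rw [hz, sub_zero] at h
    refine h.trans ?_
    rw [Finset.mul_sum]
    refine Finset.sum_le_sum fun x _ => ?_
    simp only [Pi.zero_apply, sub_zero, norm_zero, add_zero]
    rw [mul_comm]
    refine mul_le_mul_of_nonneg_right ?_ (norm_nonneg _)
    have := sum_geomKernel_mul_stoppedFun_le a S f ht (Nat.zero_le N) x
    have : 0 ≤ 10 ^ d * t := by positivity
    linarith
  have h1 : ∀ i ∈ Finset.range N, resolventEnergy (a (i + 1)) S (F (i + 1))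
      - resolventEnergy (a (i + 1)) S (F i)
      ≤ 2 * 10 ^ d * t * ∑ x ∈ S, ‖F (i + 1) x - F i x‖ := by
    intro i hi
    refine (resolventEnergy_sub_le (a (i + 1)) S (F (i + 1)) (F i)).trans ?_
    rw [Finset.mul_sum]
    refine Finset.sum_le_sum fun x _ => ?_
    rw [mul_comm]
    refine mul_le_mul_of_nonneg_right ?_ (norm_nonneg _)
    have h2 := sum_geomKernel_mul_stoppedFun_le a S f ht
      (Nat.succ_le_of_lt (Finset.mem_range.1 hi)) x
    -- `F i` is dominated by `F (i + 1)`, whose kernel averages at level `i + 1` are under control;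
    -- hence the factor 2.
    calc ∑ y ∈ S, geomKernel (a (i + 1)) (x - y) * (‖F (i + 1) y‖ + ‖F i y‖)
        ≤ ∑ y ∈ S, 2 * (geomKernel (a (i + 1)) (x - y) * ‖F (i + 1) y‖) := by
          refine Finset.sum_le_sum fun y _ => ?_
          have := mul_le_mul_of_nonneg_left (norm_stoppedFun_le_succ a S f t N i y)
            (geomKernel_nonneg (a (i + 1)) (x - y))
          linarith
      _ ≤ 2 * 10 ^ d * t := by
          rw [← Finset.mul_sum]
          linarith
  have h2 : ∑ i ∈ Finset.range N, (resolventEnergy (a i) S (F i)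
        - resolventEnergy (a (i + 1)) S (F i))
      = resolventEnergy (a 0) S (F 0) - resolventEnergy (a N) S (F N)
        + ∑ i ∈ Finset.range N, (resolventEnergy (a (i + 1)) S (F (i + 1))
          - resolventEnergy (a (i + 1)) S (F i)) := by
    rw [← Finset.sum_range_sub' (fun i => resolventEnergy (a i) S (F i)),
      ← Finset.sum_add_distrib]
    exact Finset.sum_congr rfl fun _ _ => by ring
  have h3 := resolventEnergy_nonneg (a N) S (F N)
  have h4 := Finset.sum_le_sum h1
  rw [← Finset.mul_sum] at h4
  have h5 := mul_le_mul_of_nonneg_left (sum_norm_stoppedFun_succ_sub_le a S f t N)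
    (show 0 ≤ 2 * 10 ^ d * t by positivity)
  rw [mul_add] at h5
  rw [h2]
  linarith

/-- Bound one factor of the square by its supremum and sum the other in `ℓ¹`. -/
lemma sum_sq_norm_latticeAverage_le {l : Fin d → ℤ} {a : Fin d → ℕ}
    (h0 : ∀ j, l j ≤ 0 ∧ 0 < l j + 2 ^ a j) {S : Finset (Fin d → ℤ)} {F : (Fin d → ℤ) → ℂ}
    (hF : ∀ x ∉ S, F x = 0) {t : ℝ} (ht : 0 ≤ t)
    (hK : ∀ n, ∑ y ∈ S, geomKernel a (n - y) * ‖F y‖ ≤ t) (Λ : Finset (Fin d → ℤ)) :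
    ∑ n ∈ Λ, ‖latticeAverage (latticeBox l (fun j => l j + 2 ^ a j)) F n‖ ^ 2
      ≤ 2 ^ d * t * ∑ x ∈ S, ‖F x‖ := by
  refine (Finset.sum_le_sum fun n _ => ?_).trans ((Finset.mul_sum _ _ _).symm.le.trans
    (mul_le_mul_of_nonneg_left (sum_norm_latticeAverage_le
      (latticeBox l (fun j => l j + 2 ^ a j)) hF Λ) (by positivity)))
  rw [sq]
  refine mul_le_mul_of_nonneg_right ((norm_latticeAverage_le h0 hF n).trans ?_) (norm_nonneg _)
  exact mul_le_mul_of_nonneg_left (hK n) (by positivity)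

/-- The constant in the weak type inequality. -/
def weakTypeConst (d : ℕ) : ℕ := 3 ^ d + 2 * (292 * 34 ^ d * (2 * 10 ^ d) + 2 ^ d * 10 ^ d)

/-- The weak type inequality for finitely many nested boxes that contain the origin and for finitely
supported functions. -/
lemma mul_card_le_of_zero_mem {l : ℕ → Fin d → ℤ} {a : ℕ → Fin d → ℕ} (ha : Monotone a)
    (h0 : ∀ i j, l i j ≤ 0 ∧ 0 < l i j + 2 ^ a i j)
    (hla : ∀ i j, a i j = a (i + 1) j → l i j = l (i + 1) j)
    {S : Finset (Fin d → ℤ)} {f : (Fin d → ℤ) → ℂ} (hf : ∀ x ∉ S, f x = 0) {t : ℝ} (ht : 0 < t)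
    (N : ℕ) (Λ : Finset (Fin d → ℤ))
    (hΛ : ∀ n ∈ Λ, t ^ 2 < ∑ i ∈ Finset.range N,
      ‖latticeAverage (latticeBox (l i) (fun j => l i j + 2 ^ a i j)) f n
        - latticeAverage (latticeBox (l (i + 1)) (fun j => l (i + 1) j + 2 ^ a (i + 1) j)) f n‖ ^ 2) :
    t * Λ.card ≤ weakTypeConst d * ∑ x ∈ S, ‖f x‖ := by
  classical
  set A : ℕ → ((Fin d → ℤ) → ℂ) → (Fin d → ℤ) → ℂ := fun i =>
    latticeAverage (latticeBox (l i) (fun j => l i j + 2 ^ a i j)) with hA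
  set F := stoppedFun a S f t N with hF
  have hFS : ∀ i, ∀ x ∉ S, F i x = 0 := fun i => stoppedFun_eq_zero hf t N i
  set p : (Fin d → ℤ) → Prop := fun n => ∃ i ≤ N,
    ∃ m ∈ latticeBox (l i) (fun j => l i j + 2 ^ a i j),
      ∃ k, i ≤ k ∧ k ≤ N ∧ t < gridMean (a k) S f (n - m) with hp
  have bad := mul_card_exceptional_le ha h0 S f ht.le N (Λ.filter p)
    fun n hn => (Finset.mem_filter.1 hn).2
  set Λ' := Λ.filter fun n => ¬ p n with hΛ'
  have hAF : ∀ n ∈ Λ', ∀ i ≤ N, A i f n = A i (F i) n := by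
    intro n hn i hi
    have hn' := (Finset.mem_filter.1 hn).2
    refine latticeAverage_congr fun m hm => ?_
    simp only [hF, stoppedFun]
    rw [if_pos]
    intro k hik hkN
    by_contra hk
    exact hn' ⟨i, hi, m, hm, k, hik, hkN, not_le.1 hk⟩
  -- The stopped function changes with the level: `A_i F_i - A_{i+1} F_{i+1}` is the difference of
  -- averages of the same `F_i`, handled by energy, minus the increment term `A_{i+1} (F_{i+1} -
  -- F_i)`.
  have split : ∀ n ∈ Λ', t ^ 2 ≤ ∑ i ∈ Finset.range N,
      (2 * ‖A i (F i) n - A (i + 1) (F i) n‖ ^ 2 + 2 * ‖A (i + 1) (F (i + 1) - F i) n‖ ^ 2) := by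
    intro n hn
    refine (hΛ n (Finset.mem_filter.1 hn).1).le.trans (Finset.sum_le_sum fun i hi => ?_)
    have hi := Finset.mem_range.1 hi
    change ‖A i f n - A (i + 1) f n‖ ^ 2 ≤ _
    rw [hAF n hn i hi.le, hAF n hn (i + 1) hi]
    have e : A i (F i) n - A (i + 1) (F (i + 1)) n
        = (A i (F i) n - A (i + 1) (F i) n) - A (i + 1) (F (i + 1) - F i) n := by
      simp only [hA]; rw [latticeAverage_sub]; ring
    rw [e]
    have := pow_le_pow_left₀ (norm_nonneg _) (norm_sub_le (A i (F i) n - A (i + 1) (F i) n)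
      (A (i + 1) (F (i + 1) - F i) n)) 2
    nlinarith [sq_nonneg (‖A i (F i) n - A (i + 1) (F i) n‖ - ‖A (i + 1) (F (i + 1) - F i) n‖)]
  have main : ∑ i ∈ Finset.range N, ∑ n ∈ Λ', ‖A i (F i) n - A (i + 1) (F i) n‖ ^ 2
      ≤ 292 * 34 ^ d * (2 * 10 ^ d * t * ∑ x ∈ S, ‖f x‖) := by
    refine (Finset.sum_le_sum fun i _ => sum_sq_norm_latticeAverage_sub_le (h0 i) (h0 (i + 1))
      (fun j => ?_) (hFS i) Λ').trans ?_
    · rcases (ha i.le_succ j).lt_or_eq with h | h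
      · exact Or.inl h
      · exact Or.inr ⟨h, hla i j h⟩
    · rw [← Finset.mul_sum]
      exact mul_le_mul_of_nonneg_left (sum_resolventEnergy_drop_le a S f ht.le N) (by positivity)
  have second : ∑ i ∈ Finset.range N, ∑ n ∈ Λ', ‖A (i + 1) (F (i + 1) - F i) n‖ ^ 2
      ≤ 2 ^ d * (10 ^ d * t) * ∑ x ∈ S, ‖f x‖ := by
    refine (Finset.sum_le_sum fun i hi => sum_sq_norm_latticeAverage_le (h0 (i + 1))
      (S := S) (F := F (i + 1) - F i) (fun x hx => ?_) (t := 10 ^ d * t) (by positivity)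
      (fun n => ?_) Λ').trans ?_
    · simp [hFS _ x hx]
    · refine le_trans (Finset.sum_le_sum fun y _ => ?_) (sum_geomKernel_mul_stoppedFun_le a S f ht.le
        (Nat.succ_le_of_lt (Finset.mem_range.1 hi)) n)
      refine mul_le_mul_of_nonneg_left ?_ (geomKernel_nonneg _ _)
      simp only [Pi.sub_apply, hF, norm_stoppedFun_succ_sub]
      linarith [norm_nonneg (stoppedFun a S f t N i y)]
    · rw [← Finset.mul_sum]
      refine mul_le_mul_of_nonneg_left ?_ (by positivity)
      have h1 := sum_norm_stoppedFun_succ_sub_le a S f t N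
      have h2 : 0 ≤ ∑ x ∈ S, ‖stoppedFun a S f t N 0 x‖ := Finset.sum_nonneg fun _ _ => norm_nonneg _
      simp only [Pi.sub_apply]
      linarith
  -- Chebyshev on the good points; the `3 ^ d` of `weakTypeConst` comes from the bad ones.
  have good : t ^ 2 * Λ'.card ≤ t * (2 * (292 * 34 ^ d * (2 * 10 ^ d) + 2 ^ d * 10 ^ d)
      * ∑ x ∈ S, ‖f x‖) := by
    have h := Finset.sum_le_sum split
    rw [Finset.sum_const, nsmul_eq_mul, Finset.sum_comm] at h
    simp_rw [Finset.sum_add_distrib, ← Finset.mul_sum] at h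
    linarith
  have good' : t * Λ'.card ≤ 2 * (292 * 34 ^ d * (2 * 10 ^ d) + 2 ^ d * 10 ^ d)
      * ∑ x ∈ S, ‖f x‖ := by
    rw [sq, mul_assoc] at good
    exact le_of_mul_le_mul_left good ht
  have hc : (Λ.card : ℝ) = (Λ.filter p).card + Λ'.card := by
    rw [hΛ']; exact_mod_cast (Finset.card_filter_add_card_filter_not p).symm
  rw [hc, weakTypeConst]
  push_cast
  linarith

end

/-! ### Boxes in arbitrary position -/

section
variable {d : ℕ}

lemma le_and_le_of_latticeBox_subset {l l' : Fin d → ℤ} {a b : Fin d → ℕ}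
    (h : latticeBox l (fun j => l j + 2 ^ a j) ⊆ latticeBox l' (fun j => l' j + 2 ^ b j))
    (j : Fin d) : l' j ≤ l j ∧ l j + 2 ^ a j ≤ l' j + 2 ^ b j := by
  have h1 : l ∈ latticeBox l (fun j => l j + 2 ^ a j) :=
    mem_latticeBox.2 fun j => ⟨le_rfl, by linarith [show (0 : ℤ) < 2 ^ a j by positivity]⟩
  have h2 : (fun j => l j + 2 ^ a j - 1) ∈ latticeBox l (fun j => l j + 2 ^ a j) :=
    mem_latticeBox.2 fun j =>
      ⟨by have : (1 : ℤ) ≤ 2 ^ a j := one_le_pow₀ (by norm_num)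
          linarith, by linarith⟩
  have h3 := mem_latticeBox.1 (h h1) j
  have h4 := mem_latticeBox.1 (h h2) j
  exact ⟨h3.1, by linarith [h4.2]⟩

lemma latticeAverage_translate (l u c : Fin d → ℤ) (f : (Fin d → ℤ) → ℂ) (n : Fin d → ℤ) :
    latticeAverage (latticeBox l u) f n
      = latticeAverage (latticeBox (l - c) (u - c)) f (n - c) := by
  have h : latticeBox l u = (latticeBox (l - c) (u - c)).map (addRightEmbedding c) := by
    ext x
    simp only [Finset.mem_map, mem_latticeBox, addRightEmbedding_apply, Pi.sub_apply]
    constructor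
    · intro hx
      exact ⟨x - c, fun j => by have := hx j; simp only [Pi.sub_apply]; constructor <;> linarith,
        by simp⟩
    · rintro ⟨y, hy, rfl⟩ j
      have := hy j
      simp only [Pi.add_apply]
      constructor <;> linarith
  rw [latticeAverage, latticeAverage, h, Finset.card_map, Finset.sum_map]
  congr 1
  refine Finset.sum_congr rfl fun m _ => ?_
  congr 1
  simp only [addRightEmbedding_apply]
  abel

/-- The weak type inequality for finitely many members of a nested sequence of boxes with dyadic
sides. -/
theorem mul_card_le_sum_enorm {E : ℕ → Finset (Fin d → ℤ)} (hE : ∀ i, HasDyadicSides (E i))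
    (hmono : Monotone E) (f : (Fin d → ℤ) → ℂ) (t : ℝ≥0) (N : ℕ) (Λ S : Finset (Fin d → ℤ))
    (hS : ∀ n ∈ Λ, ∀ i ≤ N, ∀ m ∈ E i, n - m ∈ S)
    (hΛ : ∀ n ∈ Λ, (t : ℝ≥0∞) ^ 2 < ∑ i ∈ Finset.range N,
      ‖latticeAverage (E i) f n - latticeAverage (E (i + 1)) f n‖ₑ ^ 2) :
    (t : ℝ≥0∞) * Λ.card ≤ weakTypeConst d * ∑ x ∈ S, ‖f x‖ₑ := by
  classical
  rcases eq_or_lt_of_le (show 0 ≤ t from zero_le) with rfl | ht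
  · simp
  choose l a hla using hE
  have hsub : ∀ i k, i ≤ k → ∀ j, l k j ≤ l i j ∧ l i j + 2 ^ a i j ≤ l k j + 2 ^ a k j := by
    intro i k hik
    refine le_and_le_of_latticeBox_subset ?_
    rw [← hla, ← hla]
    exact hmono hik
  have ha : Monotone a := by
    intro i k hik j
    have := hsub i k hik j
    exact (pow_le_pow_iff_right₀ (by norm_num : (1 : ℤ) < 2)).1 (by linarith)
  -- `S` contains every point that the averages in question see, so truncating `f` to `S` does not
  -- affect them.
  set g : (Fin d → ℤ) → ℂ := fun x => if x ∈ S then f x else 0 with hg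
  -- The lower corner of `E 0` belongs to every box; it is moved to the origin.
  set l' : ℕ → Fin d → ℤ := fun i => l i - l 0 with hl'
  have hbox : ∀ i, latticeBox (l' i) (fun j => l' i j + 2 ^ a i j)
      = latticeBox (l i - l 0) ((fun j => l i j + 2 ^ a i j) - l 0) := by
    intro i
    congr 1
    funext j
    simp only [hl', Pi.sub_apply]
    ring
  have havg : ∀ n ∈ Λ, ∀ i ≤ N, latticeAverage (E i) f n
      = latticeAverage (latticeBox (l' i) (fun j => l' i j + 2 ^ a i j)) g (n - l 0) := by
    intro n hn i hi
    rw [hbox, ← latticeAverage_translate, ← hla]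
    refine latticeAverage_congr fun m hm => ?_
    simp only [hg]
    rw [if_pos (hS n hn i hi m hm)]
  have key := mul_card_le_of_zero_mem (l := l') ha (fun i j => ?_) (fun i j h => ?_)
    (S := S) (f := g) (fun x hx => by simp [hg, hx]) (NNReal.coe_pos.2 ht) N
    (Λ.image fun n => n - l 0) (fun p hp => ?_)
  · rw [Finset.card_image_of_injective _ sub_left_injective] at key
    have e : ∑ x ∈ S, ‖g x‖ = ∑ x ∈ S, ‖f x‖ :=
      Finset.sum_congr rfl fun x hx => by simp [hg, hx]
    rw [e] at key
    have key2 : t * (Λ.card : ℝ≥0) ≤ (weakTypeConst d : ℝ≥0) * ∑ x ∈ S, ‖f x‖₊ := by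
      rw [← NNReal.coe_le_coe]
      push_cast
      exact key
    have key3 := ENNReal.coe_le_coe.2 key2
    push_cast at key3
    exact key3
  · have h1 := hsub 0 i (Nat.zero_le i) j
    have h2 : (0 : ℤ) < 2 ^ a 0 j := by positivity
    simp only [hl', Pi.sub_apply]
    constructor <;> linarith
  -- Nested intervals of equal length coincide.
  · have h1 := hsub i (i + 1) i.le_succ j
    rw [h] at h1
    simp only [hl', Pi.sub_apply]
    linarith
  · obtain ⟨n, hn, rfl⟩ := Finset.mem_image.1 hp
    have h := hΛ n hn
    have e : ∑ i ∈ Finset.range N,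
          ‖latticeAverage (E i) f n - latticeAverage (E (i + 1)) f n‖ₑ ^ 2
        = ((∑ i ∈ Finset.range N,
          ‖latticeAverage (E i) f n - latticeAverage (E (i + 1)) f n‖₊ ^ 2 : ℝ≥0) : ℝ≥0∞) := by
      push_cast; rfl
    rw [e, ← ENNReal.coe_pow, ENNReal.coe_lt_coe, ← NNReal.coe_lt_coe] at h
    push_cast at h
    refine h.trans_le (le_of_eq (Finset.sum_congr rfl fun i hi => ?_))
    have := Finset.mem_range.1 hi
    rw [havg n hn i this.le, havg n hn (i + 1) this]

lemma lt_squareVariation_iff (t : ℝ≥0) (u : ℕ → ℂ) :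
    (t : ℝ≥0∞) < squareVariation u
      ↔ ∃ N, (t : ℝ≥0∞) ^ 2 < ∑ i ∈ Finset.range N, ‖u i - u (i + 1)‖ₑ ^ 2 := by
  rw [squareVariation, one_div, ENNReal.lt_rpow_inv_iff (by norm_num), ENNReal.tsum_eq_iSup_nat,
    lt_iSup_iff]
  norm_num

theorem weakL1Norm_squareFunction_le {E : ℕ → Finset (Fin d → ℤ)}
    (hE : ∀ i, HasDyadicSides (E i)) (hmono : Monotone E) (f : (Fin d → ℤ) → ℂ) :
    weakL1Norm (squareFunction E f) ≤ weakTypeConst d * eLpNorm f 1 Measure.count := by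
  classical
  refine iSup_le fun t => ?_
  rw [← lintegral_indicator_one MeasurableSet.of_discrete, lintegral_count,
    eLpNorm_one_eq_lintegral_enorm, lintegral_count, ENNReal.tsum_eq_iSup_sum, ENNReal.mul_iSup]
  refine iSup_le fun Λ => ?_
  set Λ' := Λ.filter fun n => (t : ℝ≥0∞) < squareFunction E f n with hΛ'
  have e : ∑ n ∈ Λ, {n | (t : ℝ≥0∞) < squareFunction E f n}.indicator (1 : (Fin d → ℤ) → ℝ≥0∞) n
      = Λ'.card := by
    simp [Set.indicator_apply, hΛ']
  rw [e]
  have hN : ∀ n, ∃ N, n ∈ Λ' → (t : ℝ≥0∞) ^ 2 < ∑ i ∈ Finset.range N,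
      ‖latticeAverage (E i) f n - latticeAverage (E (i + 1)) f n‖ₑ ^ 2 := by
    intro n
    by_cases hn : n ∈ Λ'
    · obtain ⟨N, h⟩ := (lt_squareVariation_iff t _).1 (Finset.mem_filter.1 hn).2
      exact ⟨N, fun _ => h⟩
    · exact ⟨0, fun h => absurd h hn⟩
  choose N hN using hN
  -- A finite set of points admits one truncation level for all of them.
  set M := Λ'.sup N
  refine (mul_card_le_sum_enorm hE hmono f t M Λ'
    (Λ'.biUnion fun n => (Finset.range (M + 1)).biUnion fun i => (E i).image fun m => n - m)
    (fun n hn i hi m hm => ?_) fun n hn => (hN n hn).trans_le ?_).trans ?_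
  · simp only [Finset.mem_biUnion, Finset.mem_image, Finset.mem_range]
    exact ⟨n, hn, i, by omega, m, hm, rfl⟩
  · exact Finset.sum_le_sum_of_subset (Finset.range_subset_range.2 (Finset.le_sup hn))
  · gcongr
    exact ENNReal.sum_le_tsum _

lemma hasDyadicSides_symmetricDyadicBox (a : Fin d → ℕ) :
    HasDyadicSides (symmetricDyadicBox a) := by
  refine ⟨fun j => -2 ^ a j, fun j => a j + 1, ?_⟩
  rw [symmetricDyadicBox]
  congr 1
  funext j
  rw [pow_succ]
  ring

lemma monotone_symmetricDyadicBox {a : ℕ → Fin d → ℕ} (ha : Monotone a) :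
    Monotone fun k => symmetricDyadicBox (a k) := by
  intro i k hik x hx
  simp only [symmetricDyadicBox, mem_latticeBox] at hx ⊢
  intro j
  have h := hx j
  have h2 : (2 : ℤ) ^ a i j ≤ 2 ^ a k j := pow_le_pow_right₀ (by norm_num) (ha hik j)
  constructor <;> linarith

lemma exists_subset_latticeBox (A : Finset (Fin d → ℤ)) :
    ∃ r : ℕ, A ⊆ latticeBox (fun _ => -(r : ℤ)) (fun _ => r + 1) := by
  refine ⟨A.sup fun m => Finset.univ.sup fun j => (m j).natAbs, fun m hm => mem_latticeBox.2
    fun j => ?_⟩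
  have h1 : (m j).natAbs ≤ Finset.univ.sup fun j => (m j).natAbs :=
    Finset.le_sup (f := fun j => (m j).natAbs) (Finset.mem_univ j)
  have h2 : (Finset.univ.sup fun j => (m j).natAbs)
      ≤ A.sup fun m => Finset.univ.sup fun j => (m j).natAbs :=
    Finset.le_sup (f := fun m : Fin d → ℤ => Finset.univ.sup fun j => (m j).natAbs) hm
  omega

lemma card_latticeBox_two_mul_le (r : ℕ) :
    (latticeBox (fun _ : Fin d => -(2 * r : ℤ)) (fun _ => 2 * r + 1)).card
      ≤ 2 ^ d * (latticeBox (fun _ : Fin d => -(r : ℤ)) (fun _ => r + 1)).card := by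
  simp only [latticeBox, Fintype.card_piFinset, Int.card_Ico, Finset.prod_const, Finset.card_univ,
    Fintype.card_fin]
  rw [← mul_pow]
  gcongr
  omega

/-! ### Transference to measure-preserving actions -/

variable {X : Type*} [MeasurableSpace X] {μ : Measure X} [AddAction (Fin d → ℤ) X]
  [MeasurableConstVAdd (Fin d → ℤ) X] [VAddInvariantMeasure (Fin d → ℤ) X μ]

lemma measurable_ergodicAverage (E : Finset (Fin d → ℤ)) {φ : X → ℂ} (hφ : Measurable φ) :
    Measurable (ergodicAverage E φ) :=
  (Finset.measurable_fun_sum _ fun y _ => hφ.comp (measurable_const_vadd (-y))).const_mul _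

/-- The weak type inequality for the ergodic square function, by transference. -/
lemma mul_measure_lt_ergodic_le {E : ℕ → Finset (Fin d → ℤ)} (hE : ∀ i, HasDyadicSides (E i))
    (hmono : Monotone E) {φ : X → ℂ} (hφ : Measurable φ) (t : ℝ≥0) (N : ℕ) :
    (t : ℝ≥0∞) * μ {x | (t : ℝ≥0∞) ^ 2 < ∑ i ∈ Finset.range N,
        ‖ergodicAverage (E i) φ x - ergodicAverage (E (i + 1)) φ x‖ₑ ^ 2}
      ≤ weakTypeConst d * 2 ^ d * ∫⁻ x, ‖φ x‖ₑ ∂μ := by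
  classical
  set B := {x | (t : ℝ≥0∞) ^ 2 < ∑ i ∈ Finset.range N,
    ‖ergodicAverage (E i) φ x - ergodicAverage (E (i + 1)) φ x‖ₑ ^ 2} with hB
  have mB : MeasurableSet B := measurableSet_lt measurable_const
    (Finset.measurable_fun_sum _ fun i _ => ((measurable_ergodicAverage _ hφ).sub
      (measurable_ergodicAverage _ hφ)).enorm.pow_const 2)
  -- `E N` contains all earlier boxes, so for `n` in the cube `Q` of radius `r` the averages see
  -- only the cube `W` of radius `2 r`. The ratio of the two cardinalities is at most `2 ^ d`.
  obtain ⟨r, hr⟩ := exists_subset_latticeBox (E N)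
  set Q := latticeBox (fun _ : Fin d => -(r : ℤ)) (fun _ => (r : ℤ) + 1) with hQ
  set W := latticeBox (fun _ : Fin d => -(2 * r : ℤ)) (fun _ => 2 * (r : ℤ) + 1) with hW
  have hQ0 : (Q.card : ℝ≥0∞) ≠ 0 := by
    have : (0 : Fin d → ℤ) ∈ Q := mem_latticeBox.2 fun j => by simp
    exact_mod_cast (Finset.card_pos.2 ⟨_, this⟩).ne'
  have pt : ∀ x, (t : ℝ≥0∞) * ∑ n ∈ Q, B.indicator 1 (n +ᵥ x)
      ≤ weakTypeConst d * ∑ n ∈ W, ‖φ (n +ᵥ x)‖ₑ := by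
    intro x
    have hav : ∀ i n, ergodicAverage (E i) φ (n +ᵥ x)
        = latticeAverage (E i) (fun m => φ (m +ᵥ x)) n := by
      intro i n
      simp only [ergodicAverage, latticeAverage, vadd_vadd]
      congr 1
      exact Finset.sum_congr rfl fun y _ => by rw [neg_add_eq_sub]
    have h := mul_card_le_sum_enorm hE hmono (fun m => φ (m +ᵥ x)) t N
      (Q.filter fun n => n +ᵥ x ∈ B) W (fun n hn i hi m hm => ?_) (fun n hn => ?_)
    · refine le_trans (le_of_eq ?_) h
      congr 1
      rw [Finset.card_filter]
      push_cast
      exact Finset.sum_congr rfl fun n _ => by by_cases h : n +ᵥ x ∈ B <;> simp [h]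
    · have h1 := mem_latticeBox.1 (Finset.mem_filter.1 hn).1
      have h2 := mem_latticeBox.1 (hr (hmono hi hm))
      refine mem_latticeBox.2 fun j => ?_
      have h3 := h1 j
      have h4 := h2 j
      simp only [Pi.sub_apply]
      constructor <;> linarith
    · have := (Finset.mem_filter.1 hn).2
      simpa only [hB, Set.mem_ofPred_eq, hav] using this
  have hint := lintegral_mono (μ := μ) pt
  have e1 : ∫⁻ x, (t : ℝ≥0∞) * ∑ n ∈ Q, B.indicator 1 (n +ᵥ x) ∂μ = t * (Q.card * μ B) := by
    have mi : ∀ n : Fin d → ℤ, Measurable fun x : X => B.indicator (1 : X → ℝ≥0∞) (n +ᵥ x) :=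
      fun n => (measurable_one.indicator mB).comp (measurable_const_vadd n)
    rw [lintegral_const_mul _ (Finset.measurable_fun_sum _ fun n _ => mi n),
      lintegral_finsetSum _ fun n _ => mi n]
    congr 1
    rw [Finset.sum_congr rfl fun n _ => ((measurePreserving_vadd n μ).lintegral_comp
      (measurable_one.indicator mB)).trans (lintegral_indicator_one mB)]
    simp
  have e2 : ∫⁻ x, (weakTypeConst d : ℝ≥0∞) * ∑ n ∈ W, ‖φ (n +ᵥ x)‖ₑ ∂μ
      = weakTypeConst d * (W.card * ∫⁻ x, ‖φ x‖ₑ ∂μ) := by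
    have mi : ∀ n : Fin d → ℤ, Measurable fun x : X => ‖φ (n +ᵥ x)‖ₑ :=
      fun n => (hφ.comp (measurable_const_vadd n)).enorm
    rw [lintegral_const_mul _ (Finset.measurable_fun_sum _ fun n _ => mi n),
      lintegral_finsetSum _ fun n _ => mi n]
    congr 1
    rw [Finset.sum_congr rfl fun n _ => (measurePreserving_vadd n μ).lintegral_comp hφ.enorm]
    simp
  rw [e1, e2] at hint
  have hWQ : (W.card : ℝ≥0∞) ≤ 2 ^ d * Q.card := by exact_mod_cast card_latticeBox_two_mul_le r
  rw [← ENNReal.mul_le_mul_iff_right hQ0 (ENNReal.natCast_ne_top _)]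
  calc (Q.card : ℝ≥0∞) * (t * μ B) = t * (Q.card * μ B) := by ring
    _ ≤ weakTypeConst d * (W.card * ∫⁻ x, ‖φ x‖ₑ ∂μ) := hint
    _ ≤ weakTypeConst d * ((2 ^ d * Q.card) * ∫⁻ x, ‖φ x‖ₑ ∂μ) := by gcongr
    _ = Q.card * (weakTypeConst d * 2 ^ d * ∫⁻ x, ‖φ x‖ₑ ∂μ) := by ring

/-- The set of divergence lies in every superlevel set, so `t * μ A` stays bounded as `t` grows. -/
lemma ae_squareVariation_ergodicAverage_lt_top_of_measurable {E : ℕ → Finset (Fin d → ℤ)}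
    (hE : ∀ i, HasDyadicSides (E i)) (hmono : Monotone E) {φ : X → ℂ} (hφ : Measurable φ)
    (hi : ∫⁻ x, ‖φ x‖ₑ ∂μ ≠ ∞) :
    ∀ᵐ x ∂μ, squareVariation (fun i => ergodicAverage (E i) φ x) < ∞ := by
  set A := {x | ¬ squareVariation (fun i => ergodicAverage (E i) φ x) < ∞} with hA
  change μ A = 0
  set K : ℝ≥0∞ := weakTypeConst d * 2 ^ d * ∫⁻ x, ‖φ x‖ₑ ∂μ with hK
  have hKtop : K ≠ ∞ := ENNReal.mul_ne_top
    (ENNReal.mul_ne_top (ENNReal.natCast_ne_top _) (by simp)) hi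
  have h : ∀ t : ℝ≥0, (t : ℝ≥0∞) * μ A ≤ K := by
    intro t
    have hsub : A ⊆ ⋃ N, {x | (t : ℝ≥0∞) ^ 2 < ∑ i ∈ Finset.range N,
        ‖ergodicAverage (E i) φ x - ergodicAverage (E (i + 1)) φ x‖ₑ ^ 2} := by
      intro x hx
      rw [Set.mem_iUnion]
      refine (lt_squareVariation_iff t _).1 (lt_of_lt_of_le ENNReal.coe_lt_top (not_lt.1 hx))
    have hm : Monotone fun N => {x | (t : ℝ≥0∞) ^ 2 < ∑ i ∈ Finset.range N,
        ‖ergodicAverage (E i) φ x - ergodicAverage (E (i + 1)) φ x‖ₑ ^ 2} :=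
      fun N M hNM x hx => lt_of_lt_of_le (Set.mem_ofPred_eq ▸ hx)
        (Finset.sum_le_sum_of_subset (Finset.range_subset_range.2 hNM))
    refine (mul_le_mul_right (measure_mono hsub) _).trans ?_
    rw [hm.measure_iUnion, ENNReal.mul_iSup]
    exact iSup_le fun N => mul_measure_lt_ergodic_le hE hmono hφ t N
  by_contra hne
  have hlt : K / μ A < ∞ := ENNReal.div_lt_top hKtop hne
  obtain ⟨t, h1, _⟩ := ENNReal.lt_iff_exists_nnreal_btwn.1 hlt
  have h2 := (ENNReal.div_lt_iff (Or.inl hne) (Or.inr hKtop)).1 h1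
  exact absurd (h t) (not_le.2 h2)

theorem ae_squareVariation_ergodicAverage_lt_top {E : ℕ → Finset (Fin d → ℤ)}
    (hE : ∀ i, HasDyadicSides (E i)) (hmono : Monotone E) {φ : X → ℂ} (hφ : Integrable φ μ) :
    ∀ᵐ x ∂μ, squareVariation (fun i => ergodicAverage (E i) φ x) < ∞ := by
  obtain ⟨ψ, hψ, hφψ⟩ := hφ.aestronglyMeasurable
  have hi : ∫⁻ x, ‖ψ x‖ₑ ∂μ ≠ ∞ := by
    have e : ∫⁻ x, ‖φ x‖ₑ ∂μ = ∫⁻ x, ‖ψ x‖ₑ ∂μ :=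
      lintegral_congr_ae (hφψ.mono fun x hx => by simp only [hx])
    exact e ▸ hφ.hasFiniteIntegral.ne
  -- `ℤ^d` is countable and each translation preserves null sets, so the two functions agree along
  -- almost every orbit.
  have hall : ∀ᵐ x ∂μ, ∀ y : Fin d → ℤ, φ (y +ᵥ x) = ψ (y +ᵥ x) :=
    ae_all_iff.2 fun y => (measurePreserving_vadd y μ).quasiMeasurePreserving.ae hφψ
  filter_upwards [ae_squareVariation_ergodicAverage_lt_top_of_measurable hE hmono hψ.measurable hi,
    hall] with x hx hy
  have e : (fun i => ergodicAverage (E i) φ x) = fun i => ergodicAverage (E i) ψ x := by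
    funext i
    simp only [ergodicAverage, hy]
  rwa [e]

end

theorem mainTheorem3 (d : ℕ) :
    -- the long square function, for nested symmetric dyadic rectangles
    (∃ C : ℝ≥0, ∀ a : ℕ → Fin d → ℕ, Monotone a →
      ∀ f : (Fin d → ℤ) → ℂ, MemLp f 1 Measure.count →
        weakL1Norm (squareFunction (fun k => symmetricDyadicBox (a k)) f)
          ≤ C * eLpNorm f 1 Measure.count) ∧
    -- the square function, for nested rectangles with dyadic side lengths in any position
    (∃ C : ℝ≥0, ∀ E : ℕ → Finset (Fin d → ℤ), (∀ i, HasDyadicSides (E i)) → Monotone E →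
      ∀ f : (Fin d → ℤ) → ℂ, MemLp f 1 Measure.count →
        weakL1Norm (squareFunction E f) ≤ C * eLpNorm f 1 Measure.count) ∧
    -- almost everywhere finiteness of the ergodic square function for such rectangles
    (∀ E : ℕ → Finset (Fin d → ℤ), (∀ i, HasDyadicSides (E i)) → Monotone E →
      ∀ (X : Type*) [MeasurableSpace X] (μ : Measure X) [IsProbabilityMeasure μ]
        [AddAction (Fin d → ℤ) X] [MeasurableConstVAdd (Fin d → ℤ) X]
        [VAddInvariantMeasure (Fin d → ℤ) X μ] (φ : X → ℂ), Integrable φ μ →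
          ∀ᵐ x ∂μ, squareVariation (fun i => ergodicAverage (E i) φ x) < ∞) := by
  refine ⟨⟨weakTypeConst d, fun a ha f _ => ?_⟩, ⟨weakTypeConst d, fun E hE hmono f _ => ?_⟩,
    fun E hE hmono X _ μ _ _ _ _ φ hφ => ae_squareVariation_ergodicAverage_lt_top hE hmono hφ⟩
  · exact_mod_cast weakL1Norm_squareFunction_le
      (fun k => hasDyadicSides_symmetricDyadicBox (a k)) (monotone_symmetricDyadicBox ha) f
  · exact_mod_cast weakL1Norm_squareFunction_le hE hmono f
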